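/- Let $d\ge 1$. A $d$-periodic graph is a graph $G$ (multiple edges and loops allowed) with a free action of $\mathbb Z^d$ by graph automorphisms (no nonzero element fixes a vertex or an edge) having finitely many orbits of vertices and of edges. Graphs here are unweighted, that is, every edge has weight $1$. For a finite-index subgroup $\Lambda\le\mathbb Z^d$ let $G_\Lambda$ be the finite graph whose vertices and edges are the $\Lambda$-orbits of vertices and edges of $G$. For a finite graph $H$ let $L_H=\delta-A$ be its Laplacian matrix, where for $i\neq j$ the entry $A_{ij}$ is the number of edges between the $i$-th and $j$-th vertices, $A_{ii}=0$ (loops are ignored), and $\delta$ is the diagonal matrix of row sums of $A$; the complexity $\kappa_H$ is the order of the torsion subgroup of the abelian group presented by $L_H$. The complexity growth rate of $G$ is $$\gamma_G=\limsup_{\langle\Lambda\rangle\to\infty}\frac{1}{|\mathbb Z^d/\Lambda|}\log\kappa_{G_\Lambda},$$ where $\Lambda$ ranges over the finite-index subgroups of $\mathbb Z^d$ and $\langle\Lambda\rangle$ is the minimum Euclidean length of a nonzero vector of $\Lambda$. The $d$-dimensional grid graph $\mathbb G_d$ is the unweighted graph with vertex set $\mathbb Z^d$ in which $s$ and $s'$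 are joined by an edge exactly when they differ by $1$ in one coordinate and agree in all others, with $\mathbb Z^d$ acting by translation. Theorem. If $G$ is a connected (in particular nonempty) unweighted $d$-periodic graph, then $\gamma_G\ge\gamma_{\mathbb G_d}$. -/

import Mathlib

open Filter

/-- A `d`-periodic graph (unweighted multigraph, loops and multiple edges allowed) with vertex type
`V` and edge type `E`: the group `ℤ^d` acts on `V` and on `E`, the action preserves incidence,
is free on vertices and on edges, and has finitely many orbits of vertices and of edges. -/
structure PeriodicGraph (d : ℕ) (V E : Type*) [AddAction (Fin d → ℤ) V]
    [AddAction (Fin d → ℤ) E] extends Graph V E where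
  vertexSet_eq : vertexSet = Set.univ
  edgeSet_eq : edgeSet = Set.univ
  isLink_vadd : ∀ (s : Fin d → ℤ) (e : E) (x y : V),
    IsLink e x y → IsLink (s +ᵥ e) (s +ᵥ x) (s +ᵥ y)
  free_vertex : ∀ (s : Fin d → ℤ) (x : V), s +ᵥ x = x → s = 0
  free_edge : ∀ (s : Fin d → ℤ) (e : E), s +ᵥ e = e → s = 0
  finite_vertexOrbits : Finite (AddAction.orbitRel.Quotient (Fin d → ℤ) V)
  finite_edgeOrbits : Finite (AddAction.orbitRel.Quotient (Fin d → ℤ) E)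

/-- A multigraph is connected if it is nonempty and any two vertices are joined by a
finite sequence of consecutively adjacent vertices. -/
def Graph.IsConnected {V E : Type*} (G : Graph V E) : Prop :=
  G.vertexSet.Nonempty ∧
    ∀ x ∈ G.vertexSet, ∀ y ∈ G.vertexSet, Relation.ReflTransGen G.Adj x y

noncomputable section

/-! ### Complexity of a finite multigraph (whose vertex set is the whole type `V`) -/

open Classical in
/-- The adjacency matrix: off the diagonal, the number of edges between `i` and `j`;
zero on the diagonal, so that loops are ignored. -/
def Graph.adjacencyMatrix {V E : Type*} (G : Graph V E) : Matrix V V ℤ :=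
  Matrix.of fun i j => if i = j then 0 else ({e | G.IsLink e i j}.ncard : ℤ)

open Classical in
/-- The Laplacian matrix `δ - A`, where `δ` is diagonal with the row sums of `A`. -/
def Graph.laplacianMatrix {V E : Type*} [Fintype V] (G : Graph V E) : Matrix V V ℤ :=
  Matrix.diagonal (fun i => ∑ j, G.adjacencyMatrix i j) - G.adjacencyMatrix

/-- The Laplacian group: the abelian group presented by the Laplacian matrix. -/
abbrev Graph.LaplacianGroup {V E : Type*} [Fintype V] (G : Graph V E) : Type _ :=
  (V → ℤ) ⧸ LinearMap.range G.laplacianMatrix.mulVecLin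

/-- The torsion complexity: the order of the torsion subgroup of the Laplacian group. -/
def Graph.complexity {V E : Type*} [Fintype V] (G : Graph V E) : ℕ :=
  Nat.card (Submodule.torsion ℤ G.LaplacianGroup)

/-! ### Finite quotients and growth rate -/

namespace PeriodicGraph

variable {d : ℕ} {V E : Type*} [AddAction (Fin d → ℤ) V] [AddAction (Fin d → ℤ) E]

/-- The intermediate covering graph `G_Λ`: vertices and edges are the `Λ`-orbits of vertices and
edges of `G`, and an orbit of edges joins the orbits of its ends. -/
def quotient (G : PeriodicGraph d V E) (Λ : AddSubgroup (Fin d → ℤ)) :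
    Graph (AddAction.orbitRel.Quotient Λ V) (AddAction.orbitRel.Quotient Λ E) where
  vertexSet := Set.univ
  IsLink e x y := ∃ (e' : E) (x' y' : V), G.IsLink e' x' y' ∧
    Quotient.mk (AddAction.orbitRel Λ E) e' = e ∧
    Quotient.mk (AddAction.orbitRel Λ V) x' = x ∧
    Quotient.mk (AddAction.orbitRel Λ V) y' = y
  isLink_symm := by
    intro e _
    exact ⟨fun x y ⟨e', x', y', h, he, hx, hy⟩ => ⟨e', y', x', h.symm, he, hy, hx⟩⟩
  eq_or_eq_of_isLink_of_isLink := by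
    rintro e x y v w ⟨e₁, x₁, y₁, h₁, he₁, rfl, rfl⟩ ⟨e₂, x₂, y₂, h₂, he₂, rfl, rfl⟩
    obtain ⟨s, hs⟩ : e₁ ∈ AddAction.orbit Λ e₂ := Quotient.exact (he₁.trans he₂.symm)
    have hs' : (s : Fin d → ℤ) +ᵥ e₂ = e₁ := hs
    have h₃ := G.isLink_vadd s _ _ _ h₂
    rw [hs'] at h₃
    refine (h₁.left_eq_or_eq h₃).imp (fun h => ?_) (fun h => ?_)
    · exact Quotient.sound ⟨s, h.symm⟩
    · exact Quotient.sound ⟨s, h.symm⟩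
  left_mem_of_isLink := fun _ _ _ _ => Set.mem_univ _

/-- A finite-index subgroup has finitely many orbits of vertices. -/
theorem finite_quotient (G : PeriodicGraph d V E) (Λ : AddSubgroup (Fin d → ℤ))
    [Λ.FiniteIndex] : Finite (AddAction.orbitRel.Quotient Λ V) := by
  have := G.finite_vertexOrbits
  let f : ((Fin d → ℤ) ⧸ Λ) × AddAction.orbitRel.Quotient (Fin d → ℤ) V →
      AddAction.orbitRel.Quotient Λ V :=
    fun p => Quotient.mk (AddAction.orbitRel Λ V) (p.1.out +ᵥ p.2.out)
  refine Finite.of_surjective f fun q => ?_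
  induction q using Quotient.inductionOn with
  | _ v =>
    obtain ⟨g, hg⟩ : v ∈ AddAction.orbit (Fin d → ℤ)
        (Quotient.mk (AddAction.orbitRel (Fin d → ℤ) V) v).out :=
      Quotient.exact (Quotient.out_eq (Quotient.mk (AddAction.orbitRel (Fin d → ℤ) V) v)).symm
    refine ⟨((g : (Fin d → ℤ) ⧸ Λ), Quotient.mk _ v), Quotient.sound ?_⟩
    obtain ⟨h, hh⟩ := QuotientAddGroup.mk_out_eq_add Λ g
    refine ⟨h, ?_⟩
    have hg' : g +ᵥ (Quotient.mk (AddAction.orbitRel (Fin d → ℤ) V) v).out = v := hg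
    change (h : Fin d → ℤ) +ᵥ v = (Quotient.out (g : (Fin d → ℤ) ⧸ Λ)) +ᵥ _
    rw [hh, add_comm, add_vadd, hg']

/-- The complexity of `G_Λ` for a finite-index subgroup `Λ`. -/
def quotientComplexity (G : PeriodicGraph d V E) (Λ : AddSubgroup (Fin d → ℤ))
    [Λ.FiniteIndex] : ℕ :=
  have := G.finite_quotient Λ
  letI := Fintype.ofFinite (AddAction.orbitRel.Quotient Λ V)
  (G.quotient Λ).complexity

end PeriodicGraph

/-- The type of finite-index subgroups of `ℤ^d`. -/
abbrev FiniteIndexSubgroup (d : ℕ) : Type :=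
  {Λ : AddSubgroup (Fin d → ℤ) // Λ.FiniteIndex}

/-- `⟨Λ⟩`: the minimum (Euclidean) length of a nonzero vector of `Λ`. -/
def FiniteIndexSubgroup.minLength {d : ℕ} (Λ : FiniteIndexSubgroup d) : ℝ :=
  sInf {r : ℝ | ∃ v ∈ Λ.1, v ≠ 0 ∧ r = √(∑ i, (v i : ℝ) ^ 2)}

/-- The complexity growth rate: the limit superior, as `⟨Λ⟩ → ∞`, of
`(1 / |ℤ^d / Λ|) * log κ(G_Λ)` over the finite-index subgroups `Λ` of `ℤ^d`.
It is taken in the extended reals, where it always makes sense. -/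
def PeriodicGraph.growthRate {d : ℕ} {V E : Type*} [AddAction (Fin d → ℤ) V]
    [AddAction (Fin d → ℤ) E] (G : PeriodicGraph d V E) : EReal :=
  limsup (fun Λ : FiniteIndexSubgroup d =>
      have := Λ.2
      (((1 / (Λ.1.index : ℝ)) * Real.log (G.quotientComplexity Λ.1) : ℝ) : EReal))
    (comap FiniteIndexSubgroup.minLength atTop)

/-! ### The grid graph -/

/-- Edges of the `d`-dimensional grid: `⟨s, i⟩` is the edge joining `s` and `s + e_i`. -/
@[ext]
structure GridEdge (d : ℕ) where
  base : Fin d → ℤ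
  dir : Fin d

instance (d : ℕ) : AddAction (Fin d → ℤ) (GridEdge d) where
  vadd s e := ⟨s + e.base, e.dir⟩
  zero_vadd e := GridEdge.ext (zero_add e.base) rfl
  add_vadd s t e := GridEdge.ext (add_assoc s t e.base) rfl

/-- The `d`-dimensional grid graph, with vertex set `ℤ^d` and `ℤ^d` acting by translation. -/
def gridGraph (d : ℕ) : PeriodicGraph d (Fin d → ℤ) (GridEdge d) where
  vertexSet := Set.univ
  edgeSet := Set.univ
  IsLink e x y := (x = e.base ∧ y = e.base + Pi.single e.dir 1) ∨
    (y = e.base ∧ x = e.base + Pi.single e.dir 1)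
  isLink_symm := fun _ _ => ⟨fun _ _ h => h.symm⟩
  eq_or_eq_of_isLink_of_isLink := by
    rintro e x y v w (⟨rfl, rfl⟩ | ⟨rfl, rfl⟩) (⟨rfl, rfl⟩ | ⟨rfl, rfl⟩) <;> simp
  edge_mem_iff_exists_isLink := fun e => by
    simp only [Set.mem_univ, true_iff]
    exact ⟨_, _, Or.inl ⟨rfl, rfl⟩⟩
  left_mem_of_isLink := fun _ _ _ _ => Set.mem_univ _
  vertexSet_eq := rfl
  edgeSet_eq := rfl
  isLink_vadd := by
    rintro s e x y (⟨rfl, rfl⟩ | ⟨rfl, rfl⟩)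
    · exact Or.inl ⟨rfl, (add_assoc _ _ _).symm⟩
    · exact Or.inr ⟨rfl, (add_assoc _ _ _).symm⟩
  free_vertex := fun s x h => by simpa using h
  free_edge := fun s e h => by
    have h' : s + e.base = e.base := congrArg GridEdge.base h
    simpa using h'
  finite_vertexOrbits := by
    refine Finite.of_surjective (fun _ : Unit => Quotient.mk _ 0) fun q => ?_
    induction q using Quotient.inductionOn with
    | _ v => exact ⟨(), Quotient.sound ⟨-v, by simp⟩⟩
  finite_edgeOrbits := by
    refine Finite.of_surjective
      (fun i : Fin d => Quotient.mk (AddAction.orbitRel (Fin d → ℤ) (GridEdge d)) ⟨0, i⟩) fun q => ?_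
    induction q using Quotient.inductionOn with
    | _ e => exact ⟨e.dir, Quotient.sound ⟨-e.base, GridEdge.ext (neg_add_cancel e.base) rfl⟩⟩

end

/-!
The complexity of a connected finite graph is the determinant of its Laplacian with the row and the
column of one vertex removed (`Graph.complexity_eq_det`), that is, the number of its spanning trees.
This number does not increase when the graph is replaced by a minor: a maximal spanning forest of
a minor extends to a spanning tree of the graph. So it is enough to find, in suitable finite
quotients of `G`, minors made of many disjoint copies of finite quotients of the grid.

Contract all translates of a connected transversal of the vertex orbits. What remains is a connected
Cayley graph of `ℤ^d`, whose generators therefore contain `d` linearly independent vectors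
`A e_1, …, A e_d`. The edges in these directions form `c` copies of the grid, one for each coset of
the range of `A`, where `c` is the index of this range (`PeriodicGraph.exists_grid_copies`). Modulo
`A Λ` they form `c` copies of the quotient of the grid by `Λ`, whence
`κ(𝔾_Λ) ^ c ≤ κ(G_{A Λ})` (`PeriodicGraph.exists_quotientComplexity_pow_le`). As `A Λ` has index
`c · |ℤ^d / Λ|`, and its shortest vectors grow with those of `Λ`, the inequality of the upper limits
follows.

The inequality between the complexities is proved with determinants instead of forests
(`Graph.det_pow_card_le_det`). The copies are disconnected from each other, so the minor is formed by
also contracting a tree which joins one vertex of each copy; the contracted forest is described by a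
parent function. In the coordinates which are the increments along the contracted forest and the
values at the remaining vertices, the quadratic form of the reduced Laplacian dominates the sum of
the squares of the increments, and where these vanish it dominates the form of the copies of the
grid. By the Schur complement its determinant is at least that of the latter form
(`Matrix.PosDef.det_le_det_of_coordinates`).
-/

noncomputable section

/-! ### Determinants of positive semidefinite matrices -/

section Determinant

open Matrix
open scoped MatrixOrder

theorem Matrix.PosSemidef.one_le_det_one_add {n : Type*} [Fintype n] [DecidableEq n]
    {P : Matrix n n ℝ} (hP : P.PosSemidef) : 1 ≤ (1 + P).det := by
  have hspec := hP.1.spectral_theorem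
  have h : 1 + P = Unitary.conjStarAlgAut ℝ _ hP.1.eigenvectorUnitary
      (1 + diagonal (RCLike.ofReal ∘ hP.1.eigenvalues)) := by
    rw [map_add, map_one, ← hspec]
  rw [h, Unitary.conjStarAlgAut_apply, det_mul_right_comm,
    Unitary.mul_star_self_of_mem hP.1.eigenvectorUnitary.2, one_mul]
  rw [← diagonal_one, diagonal_add, det_diagonal]
  exact Finset.one_le_prod fun i _ => by simpa using hP.eigenvalues_nonneg i

theorem Matrix.PosSemidef.det_le_det {n : Type*} [Fintype n] [DecidableEq n]
    {A B : Matrix n n ℝ} (hA : A.PosSemidef) (hAB : (B - A).PosSemidef) : A.det ≤ B.det := by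
  -- if `det A ≠ 0`, then `A = Cᴴ C` with `C` invertible, and conjugation reduces to `A = 1`
  rcases eq_or_ne A.det 0 with h0 | h0
  · rw [h0]
    have : B = A + (B - A) := by abel
    rw [this]
    exact (hA.add hAB).det_nonneg
  obtain ⟨C, rfl⟩ : ∃ C : Matrix n n ℝ, A = Cᴴ * C :=
    CStarAlgebra.nonneg_iff_eq_star_mul_self.mp hA.nonneg
  have hC : IsUnit C.det := by
    rw [det_mul] at h0
    exact (right_ne_zero_of_mul h0).isUnit
  have hCH : IsUnit Cᴴ.det := by simpa using hC
  have hB : B = Cᴴ * (1 + (C⁻¹)ᴴ * (B - Cᴴ * C) * C⁻¹) * C := by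
    rw [mul_add, add_mul, mul_one, conjTranspose_nonsing_inv]
    have : Cᴴ * (Cᴴ⁻¹ * (B - Cᴴ * C) * C⁻¹) * C = B - Cᴴ * C := by
      rw [mul_assoc Cᴴ⁻¹, mul_nonsing_inv_cancel_left _ _ hCH, nonsing_inv_mul_cancel_right _ _ hC]
    rw [this]; abel
  have h1 := (hAB.conjTranspose_mul_mul_same C⁻¹).one_le_det_one_add
  have h2 : 0 ≤ C.det * C.det := mul_self_nonneg _
  rw [hB, det_mul, det_mul, det_mul, det_conjTranspose, star_trivial]
  nlinarith

/-- If the quadratic form of `M` dominates the sum of the squares of the coordinates in `C`, then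
the Schur complement of the `U`-block of `M` is at least the identity, so that deleting the
coordinates in `C` does not increase the determinant. -/
theorem Matrix.PosDef.det_toBlocks₁₁_le {U C : Type*} [Fintype U] [DecidableEq U] [Fintype C]
    [DecidableEq C] {M : Matrix (U ⊕ C) (U ⊕ C) ℝ} (hM : M.PosDef)
    (h : ∀ x, ∑ c, x (Sum.inr c) ^ 2 ≤ x ⬝ᵥ M *ᵥ x) : M.toBlocks₁₁.det ≤ M.det := by
  have hA : M.toBlocks₁₁.PosDef := hM.submatrix Sum.inl_injective
  have : Invertible M.toBlocks₁₁ := hA.isUnit.invertible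
  have hH : M.toBlocks₂₁ = M.toBlocks₁₂ᴴ := by
    ext i j
    have := congrFun (congrFun hM.1 (Sum.inr i)) (Sum.inl j)
    simpa [toBlocks₂₁, toBlocks₁₂] using this.symm
  have hMb : M = fromBlocks M.toBlocks₁₁ M.toBlocks₁₂ M.toBlocks₁₂ᴴ M.toBlocks₂₂ := by
    rw [← hH, fromBlocks_toBlocks]
  have hsub : M - fromBlocks 0 0 0 1 =
      fromBlocks M.toBlocks₁₁ M.toBlocks₁₂ M.toBlocks₁₂ᴴ (M.toBlocks₂₂ - 1) := by
    conv_lhs => rw [hMb]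
    rw [sub_eq_add_neg, fromBlocks_neg, fromBlocks_add]
    simp [sub_eq_add_neg]
  have hD : (fromBlocks 0 0 0 1 : Matrix (U ⊕ C) (U ⊕ C) ℝ).IsHermitian := by
    rw [IsHermitian, fromBlocks_conjTranspose]; simp
  have hpsd : (M - fromBlocks 0 0 0 1).PosSemidef := by
    refine .of_dotProduct_mulVec_nonneg (hM.1.sub hD) fun x => ?_
    have := h x
    rw [star_trivial, sub_mulVec, dotProduct_sub]
    have h2 : x ⬝ᵥ (fromBlocks 0 0 0 1 : Matrix (U ⊕ C) (U ⊕ C) ℝ) *ᵥ x =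
        ∑ c, x (Sum.inr c) ^ 2 := by
      rw [fromBlocks_mulVec]
      simp [dotProduct, pow_two]
    linarith
  rw [hsub, PosDef.fromBlocks₁₁ _ _ hA] at hpsd
  have hS : M.toBlocks₂₂ - M.toBlocks₁₂ᴴ * ⅟ M.toBlocks₁₁ * M.toBlocks₁₂ =
      1 + (M.toBlocks₂₂ - 1 - M.toBlocks₁₂ᴴ * M.toBlocks₁₁⁻¹ * M.toBlocks₁₂) := by
    rw [invOf_eq_nonsing_inv]; abel
  have hdet : M.det = M.toBlocks₁₁.det *
      (M.toBlocks₂₂ - M.toBlocks₁₂ᴴ * ⅟ M.toBlocks₁₁ * M.toBlocks₁₂).det := by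
    conv_lhs => rw [hMb]
    rw [det_fromBlocks₁₁]
  rw [hdet, hS]
  exact le_mul_of_one_le_right hA.det_pos.le hpsd.one_le_det_one_add

/-- Comparison of the determinant of `M` with that of a form `H` in fewer variables, after the
unimodular change of coordinates `x ↦ N x`. It suffices to bound `M` below by the squares of the
coordinates in `C` everywhere, and by `H` where these coordinates vanish. -/
theorem Matrix.PosDef.det_le_det_of_coordinates {U C : Type*} [Fintype U] [DecidableEq U]
    [Fintype C] [DecidableEq C] {M : Matrix (U ⊕ C) (U ⊕ C) ℝ} (hM : M.PosDef)
    {N : Matrix (U ⊕ C) (U ⊕ C) ℝ} (hN : N.det = 1) {H : Matrix U U ℝ} (hH : H.PosSemidef)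
    (h₁ : ∀ x, ∑ c, (N *ᵥ x) (Sum.inr c) ^ 2 ≤ x ⬝ᵥ M *ᵥ x)
    (h₂ : ∀ x, (∀ c, (N *ᵥ x) (Sum.inr c) = 0) →
      ((N *ᵥ x) ∘ Sum.inl) ⬝ᵥ H *ᵥ ((N *ᵥ x) ∘ Sum.inl) ≤ x ⬝ᵥ M *ᵥ x) :
    H.det ≤ M.det := by
  have hNu : IsUnit N.det := by simp [hN]
  have hRinj : Function.Injective N⁻¹.mulVec := by
    rw [mulVec_injective_iff_isUnit, isUnit_nonsing_inv_iff, isUnit_iff_isUnit_det]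
    exact hNu
  have hNR : ∀ y, N *ᵥ (N⁻¹ *ᵥ y) = y := fun y => by
    rw [mulVec_mulVec, mul_nonsing_inv _ hNu, one_mulVec]
  have hM' : ((N⁻¹)ᴴ * M * N⁻¹).PosDef := hM.conjTranspose_mul_mul_same hRinj
  have hq : ∀ y, y ⬝ᵥ ((N⁻¹)ᴴ * M * N⁻¹) *ᵥ y = (N⁻¹ *ᵥ y) ⬝ᵥ M *ᵥ (N⁻¹ *ᵥ y) := fun y => by
    rw [← mulVec_mulVec, ← mulVec_mulVec, dotProduct_mulVec, conjTranspose_eq_transpose_of_trivial,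
      vecMul_transpose]
  have hdet : ((N⁻¹)ᴴ * M * N⁻¹).det = M.det := by
    rw [det_mul, det_mul, det_conjTranspose, det_nonsing_inv, hN]; simp
  rw [← hdet]
  refine le_trans (hH.det_le_det (.of_dotProduct_mulVec_nonneg ?_ fun y => ?_))
    (hM'.det_toBlocks₁₁_le fun y => ?_)
  · exact (hM'.submatrix Sum.inl_injective).1.sub hH.1
  · have := h₂ (N⁻¹ *ᵥ Sum.elim y 0) (fun c => by rw [hNR]; simp)
    rw [hNR, ← hq] at this
    rw [star_trivial, sub_mulVec, dotProduct_sub, sub_nonneg]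
    refine this.trans (le_of_eq ?_)
    conv_lhs => rw [← fromBlocks_toBlocks ((N⁻¹)ᴴ * M * N⁻¹), fromBlocks_mulVec]
    simp [dotProduct]
  · have := h₁ (N⁻¹ *ᵥ y)
    rwa [hNR, ← hq] at this

end Determinant

/-! ### The reduced Laplacian and the complexity -/

section ReducedLaplacian

variable {V E : Type*} (G : Graph V E)

theorem Graph.adjacencyMatrix_symm (i j : V) : G.adjacencyMatrix i j = G.adjacencyMatrix j i := by
  classical
  simp only [adjacencyMatrix, Matrix.of_apply, eq_comm (a := i) (b := j)]
  congr 3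
  ext e
  exact G.isLink_comm

theorem Graph.adjacencyMatrix_nonneg (i j : V) : 0 ≤ G.adjacencyMatrix i j := by
  classical
  simp only [adjacencyMatrix, Matrix.of_apply]
  split_ifs <;> simp

theorem Graph.one_le_adjacencyMatrix [Finite E] {G : Graph V E} {i j : V} (hij : i ≠ j)
    (h : G.Adj i j) : 1 ≤ G.adjacencyMatrix i j := by
  classical
  obtain ⟨e, he⟩ := h
  simp only [adjacencyMatrix, Matrix.of_apply, if_neg hij]
  exact_mod_cast (Set.ncard_pos (Set.toFinite _)).2 ⟨e, he⟩

variable [Fintype V]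

theorem Graph.laplacianMatrix_mulVec (f : V → ℤ) (i : V) :
    (G.laplacianMatrix.mulVec f) i = ∑ j, G.adjacencyMatrix i j * (f i - f j) := by
  classical
  rw [laplacianMatrix, Matrix.sub_mulVec, Pi.sub_apply, Matrix.mulVec_diagonal]
  simp [Matrix.mulVec, dotProduct, Finset.sum_mul, mul_sub]

theorem Graph.sum_laplacianMatrix_mulVec (f : V → ℤ) :
    ∑ i, (G.laplacianMatrix.mulVec f) i = 0 := by
  simp only [laplacianMatrix_mulVec, mul_sub, Finset.sum_sub_distrib]
  rw [sub_eq_zero, Finset.sum_comm]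
  simp only [G.adjacencyMatrix_symm]

variable [DecidableEq V]

/-- The reduced Laplacian: the Laplacian matrix with the row and the column of `r` removed. -/
def Graph.reducedLaplacian (r : V) : Matrix {x // x ≠ r} {x // x ≠ r} ℤ :=
  G.laplacianMatrix.submatrix (↑) (↑)

/-- The extension of a function on the vertices other than `r` by the value `0` at `r`. -/
def extendByZero {R : Type*} [Zero R] (r : V) (f : {x // x ≠ r} → R) (x : V) : R :=
  if h : x ≠ r then f ⟨x, h⟩ else 0

omit [Fintype V] in
@[simp]
theorem extendByZero_self {R : Type*} [Zero R] (r : V) (f : {x // x ≠ r} → R) :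
    extendByZero r f r = 0 := by
  simp [extendByZero]

omit [Fintype V] in
@[simp]
theorem extendByZero_coe {R : Type*} [Zero R] (r : V) (f : {x // x ≠ r} → R) (x : {x // x ≠ r}) :
    extendByZero r f x = f x := by
  simp [extendByZero, x.2]

theorem sum_eq_add_sum_ne {R : Type*} [AddCommMonoid R] (r : V) (f : V → R) :
    ∑ x, f x = f r + ∑ x : {x // x ≠ r}, f x := by
  rw [Fintype.sum_eq_add_sum_compl r f]
  congr 1
  exact Finset.sum_subtype _ (by simp) f

theorem Graph.reducedLaplacian_mulVec (r : V) (f : {x // x ≠ r} → ℤ) (x : {x // x ≠ r}) :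
    ((G.reducedLaplacian r).mulVec f) x = (G.laplacianMatrix.mulVec (extendByZero r f)) x := by
  simp only [Matrix.mulVec, dotProduct]
  rw [sum_eq_add_sum_ne r]
  simp [reducedLaplacian]

/-- The group presented by a nonsingular integer matrix has order `|det M|`. -/
theorem Matrix.card_quotient_range_mulVecLin {n : Type*} [Fintype n] [DecidableEq n]
    (M : Matrix n n ℤ) (hM : M.det ≠ 0) :
    Nat.card ((n → ℤ) ⧸ LinearMap.range M.mulVecLin) = M.det.natAbs := by
  have hinj : Function.Injective M.mulVecLin := Matrix.mulVec_injective_of_det_ne_zero hM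
  let e := LinearEquiv.ofInjective M.mulVecLin hinj
  rw [← Submodule.natAbs_det_equiv _ e]
  congr 1
  rw [← LinearMap.det_toLin' M]
  rfl

/-- A form of the matrix-tree theorem: restriction of functions to the vertices other than `r`
carries the torsion subgroup of the Laplacian group, which consists of the classes of functions
of sum zero, isomorphically onto the group presented by the reduced Laplacian. -/
theorem Graph.complexity_eq_natAbs_det (r : V) (h : (G.reducedLaplacian r).det ≠ 0) :
    G.complexity = (G.reducedLaplacian r).det.natAbs := by
  rw [← Matrix.card_quotient_range_mulVecLin _ h]
  have hext : ∀ x y : V → ℤ, ∑ i, x i = ∑ i, y i → (∀ i : {i // i ≠ r}, x i = y i) → x = y := by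
    intro x y hs hxy
    rw [sum_eq_add_sum_ne r x, sum_eq_add_sum_ne r y, Finset.sum_congr rfl fun i _ => hxy i] at hs
    funext i
    by_cases hi : i = r
    · rw [hi]; exact add_right_cancel hs
    · exact hxy ⟨i, hi⟩
  let ρ : (V → ℤ) →ₗ[ℤ] ({x // x ≠ r} → ℤ) := LinearMap.funLeft ℤ ℤ (↑)
  have hρ : ∀ x i, ρ x i = x i := fun _ _ => rfl
  have hle : LinearMap.range G.laplacianMatrix.mulVecLin ≤
      (LinearMap.range (G.reducedLaplacian r).mulVecLin).comap ρ := by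
    rintro _ ⟨f, rfl⟩
    -- subtracting the constant `f r` does not change `L f`
    refine ⟨fun i => f i - f r, ?_⟩
    funext i
    rw [Matrix.mulVecLin_apply, Matrix.mulVecLin_apply, reducedLaplacian_mulVec, hρ,
      laplacianMatrix_mulVec, laplacianMatrix_mulVec]
    have : ∀ j, extendByZero r (fun i : {i // i ≠ r} => f i - f r) j = f j - f r := by
      intro j
      by_cases hj : j = r
      · simp [hj]
      · exact extendByZero_coe r _ ⟨j, hj⟩
    simp [this]
  let q := Submodule.mapQ _ _ ρ hle
  -- torsion classes have sum zero, since the range of the Laplacian has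
  have hsum : ∀ x : V → ℤ, (Submodule.Quotient.mk x : G.LaplacianGroup) ∈
      Submodule.torsion ℤ G.LaplacianGroup → ∑ i, x i = 0 := by
    intro x hx
    obtain ⟨n, hn⟩ := (Submodule.mem_torsion_iff _).1 hx
    have hn' : (Submodule.Quotient.mk ((n : ℤ) • x) : G.LaplacianGroup) = 0 := hn
    rw [Submodule.Quotient.mk_eq_zero] at hn'
    obtain ⟨f, hf⟩ := hn'
    have := G.sum_laplacianMatrix_mulVec f
    rw [Matrix.mulVecLin_apply] at hf
    rw [hf] at this
    simp only [Pi.smul_apply, smul_eq_mul, ← Finset.mul_sum] at this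
    exact (mul_eq_zero.1 this).resolve_left (nonZeroDivisors.ne_zero n.2)
  refine Nat.card_congr (Equiv.ofBijective
    (q.comp (Submodule.subtype (Submodule.torsion ℤ G.LaplacianGroup))) ⟨?_, ?_⟩)
  · rw [← LinearMap.ker_eq_bot, LinearMap.ker_eq_bot']
    rintro ⟨x, hx⟩ h0
    induction x using Submodule.Quotient.induction_on with
    | _ x =>
    have h0' : (Submodule.Quotient.mk (ρ x) : _ ⧸ LinearMap.range (G.reducedLaplacian r).mulVecLin)
      = 0 := h0
    rw [Submodule.Quotient.mk_eq_zero] at h0'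
    obtain ⟨g, hg⟩ := h0'
    rw [Submodule.mk_eq_zero, Submodule.Quotient.mk_eq_zero]
    refine ⟨extendByZero r g, hext _ _ ?_ fun i => ?_⟩
    · rw [hsum x hx, Matrix.mulVecLin_apply, sum_laplacianMatrix_mulVec]
    · rw [Matrix.mulVecLin_apply, ← reducedLaplacian_mulVec]
      exact congrFun hg i
  · intro z
    induction z using Submodule.Quotient.induction_on with
    | _ z =>
    -- extend `z` by the value at `r` that makes the sum zero; then `det • x` is in the range of `L`
    let x : V → ℤ := fun i => if i = r then -∑ j, z j else extendByZero r z i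
    have hx : ∀ i : {i // i ≠ r}, x i = z i := fun i => by simp [x, i.2]
    have hxs : ∑ i, x i = 0 := by
      rw [sum_eq_add_sum_ne r, Finset.sum_congr rfl fun i _ => hx i]
      simp [x]
    refine ⟨⟨Submodule.Quotient.mk x, ?_⟩, ?_⟩
    · refine (Submodule.mem_torsion_iff _).2
        ⟨⟨(G.reducedLaplacian r).det, mem_nonZeroDivisors_of_ne_zero h⟩, ?_⟩
      change (Submodule.Quotient.mk ((G.reducedLaplacian r).det • x) : G.LaplacianGroup) = 0
      rw [Submodule.Quotient.mk_eq_zero]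
      refine ⟨extendByZero r ((G.reducedLaplacian r).adjugate.mulVec z), hext _ _ ?_ fun i => ?_⟩
      · rw [Matrix.mulVecLin_apply, sum_laplacianMatrix_mulVec]
        simp [← Finset.mul_sum, hxs]
      · rw [Matrix.mulVecLin_apply, ← reducedLaplacian_mulVec, Matrix.mulVec_mulVec,
          Matrix.mul_adjugate]
        simp [hx]
    · change (Submodule.Quotient.mk (ρ x) : _ ⧸ LinearMap.range (G.reducedLaplacian r).mulVecLin)
        = Submodule.Quotient.mk z
      congr 1
      funext i
      exact hx i

/-! ### The quadratic form of the reduced Laplacian -/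

/-- The reduced Laplacian as a real matrix. -/
abbrev Graph.realReducedLaplacian (r : V) : Matrix {x // x ≠ r} {x // x ≠ r} ℝ :=
  (G.reducedLaplacian r).map (Int.cast : ℤ → ℝ)

/-- The Dirichlet form; each edge is counted from both of its ends. -/
theorem Graph.dotProduct_realReducedLaplacian_mulVec (r : V) (f : {x // x ≠ r} → ℝ) :
    f ⬝ᵥ (G.realReducedLaplacian r).mulVec f =
      (∑ i, ∑ j, (G.adjacencyMatrix i j : ℝ) * (extendByZero r f i - extendByZero r f j) ^ 2) / 2 := by
  set F := extendByZero r f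
  have hL : ∀ x : {x // x ≠ r}, ((G.realReducedLaplacian r).mulVec f) x =
      ∑ j, (G.adjacencyMatrix x j : ℝ) * (F x - F j) := by
    intro x
    have h1 : ((G.realReducedLaplacian r).mulVec f) x = ∑ j, (G.laplacianMatrix x j : ℝ) * F j := by
      rw [sum_eq_add_sum_ne r]
      simp [Matrix.mulVec, dotProduct, reducedLaplacian, F]
    rw [h1]
    simp only [laplacianMatrix, Matrix.sub_apply, Matrix.diagonal_apply, mul_sub]
    push_cast
    simp only [sub_mul, Finset.sum_sub_distrib]
    simp [Finset.sum_mul]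
  have h2 : f ⬝ᵥ (G.realReducedLaplacian r).mulVec f =
      ∑ i, ∑ j, (G.adjacencyMatrix i j : ℝ) * (F i * (F i - F j)) := by
    rw [sum_eq_add_sum_ne r]
    simp only [dotProduct, hL, Finset.mul_sum]
    simp only [F, extendByZero_self, zero_mul, mul_zero, Finset.sum_const_zero, zero_add,
      extendByZero_coe]
    exact Finset.sum_congr rfl fun i _ => Finset.sum_congr rfl fun j _ => by ring
  have h3 : ∑ i, ∑ j, (G.adjacencyMatrix i j : ℝ) * (F i * (F i - F j)) =
      ∑ i, ∑ j, (G.adjacencyMatrix i j : ℝ) * (F j * (F j - F i)) := by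
    rw [Finset.sum_comm]
    simp only [G.adjacencyMatrix_symm]
  rw [h2, eq_div_iff two_ne_zero, mul_two]
  nth_rewrite 2 [h3]
  simp only [← Finset.sum_add_distrib]
  exact Finset.sum_congr rfl fun i _ => Finset.sum_congr rfl fun j _ => by ring

omit [DecidableEq V] in
theorem Graph.isHermitian_realReducedLaplacian (r : V) :
    (G.realReducedLaplacian r).IsHermitian := by
  ext i j
  rcases eq_or_ne i j with rfl | hij
  · simp
  · have h1 : (i : V) ≠ j := fun h => hij (Subtype.ext h)
    simp [reducedLaplacian, laplacianMatrix, h1, h1.symm, G.adjacencyMatrix_symm j]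

/-- The quadratic form vanishes only on functions which are constant along edges, hence, in a
connected graph, equal to their value `0` at `r`. -/
theorem Graph.posDef_realReducedLaplacian (r : V)
    (hG : ∀ x, Relation.ReflTransGen (fun a b => G.adjacencyMatrix a b ≠ 0) r x) :
    (G.realReducedLaplacian r).PosDef := by
  refine .of_dotProduct_mulVec_pos (G.isHermitian_realReducedLaplacian r) fun f hf => ?_
  rw [star_trivial, dotProduct_realReducedLaplacian_mulVec]
  have hnn : ∀ i j, 0 ≤ (G.adjacencyMatrix i j : ℝ) *
      (extendByZero r f i - extendByZero r f j) ^ 2 := fun i j =>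
    mul_nonneg (by exact_mod_cast G.adjacencyMatrix_nonneg i j) (sq_nonneg _)
  refine lt_of_le_of_ne (div_nonneg (Finset.sum_nonneg fun i _ => Finset.sum_nonneg fun j _ =>
    hnn i j) two_pos.le) fun h0 => hf ?_
  have h1 : ∀ i j, (G.adjacencyMatrix i j : ℝ) *
      (extendByZero r f i - extendByZero r f j) ^ 2 = 0 := fun i j => by
    have := (div_eq_zero_iff.1 h0.symm).resolve_right two_ne_zero
    rw [Finset.sum_eq_zero_iff_of_nonneg fun i _ => Finset.sum_nonneg fun j _ => hnn i j] at this
    exact (Finset.sum_eq_zero_iff_of_nonneg fun j _ => hnn i j).1 (this i (Finset.mem_univ _)) j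
      (Finset.mem_univ _)
  have h2 : ∀ x, extendByZero r f x = 0 := by
    intro x
    induction hG x with
    | refl => simp
    | tail _ hab ih =>
      rename_i a b _
      rcases mul_eq_zero.1 (h1 a b) with h | h
      · exact absurd (by exact_mod_cast h) hab
      · rw [ih] at h; simpa using h
  funext x
  rw [← extendByZero_coe r f, h2]; rfl

theorem Graph.complexity_eq_det (r : V)
    (hG : ∀ x, Relation.ReflTransGen (fun a b => G.adjacencyMatrix a b ≠ 0) r x) :
    (G.complexity : ℝ) = (G.realReducedLaplacian r).det := by
  have hpos := (G.posDef_realReducedLaplacian r hG).det_pos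
  have hcast : (G.realReducedLaplacian r).det = ((G.reducedLaplacian r).det : ℝ) :=
    (Int.cast_det _).symm
  rw [hcast] at hpos ⊢
  have hpos' : 0 < (G.reducedLaplacian r).det := by exact_mod_cast hpos
  rw [G.complexity_eq_natAbs_det r hpos'.ne', Nat.cast_natAbs, abs_of_pos hpos']

end ReducedLaplacian

/-! ### Comparing a finite graph with copies of another one -/

section Comparison

open Matrix

/-- A breadth-first forest rooted at `S`: the rank is the distance to `S` along `R`. -/
theorem exists_rank_of_forall_reflTransGen {W : Type*} (R : W → W → Prop) (S : Set W)
    (h : ∀ w, ∃ s ∈ S, Relation.ReflTransGen R s w) :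
    ∃ ρ : W → ℕ, ∀ w ∉ S, ∃ w', R w' w ∧ ρ w' < ρ w := by
  let D : ℕ → W → Prop := fun n => Nat.rec (motive := fun _ => W → Prop) (fun w => w ∈ S)
    (fun _ P w => ∃ w', R w' w ∧ P w') n
  have hD : ∀ w, ∃ n, D n w := by
    intro w
    obtain ⟨s, hs, hsw⟩ := h w
    induction hsw with
    | refl => exact ⟨0, hs⟩
    | tail _ hab ih =>
      obtain ⟨n, hn⟩ := ih
      exact ⟨n + 1, _, hab, hn⟩
  refine ⟨fun w => sInf {n | D n w}, fun w hw => ?_⟩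
  have hspec : D (sInf {n | D n w}) w := Nat.sInf_mem (hD w)
  rcases hn : sInf {n | D n w} with _ | m
  · rw [hn] at hspec; exact absurd hspec hw
  · rw [hn] at hspec
    obtain ⟨w', hR, hw'⟩ := hspec
    refine ⟨w', hR, ?_⟩
    change sInf {n | D n w'} < sInf {n | D n w}
    rw [hn]
    exact Nat.lt_succ_of_le (Nat.sInf_le hw')

/-- A matrix with unit diagonal, whose other nonzero entries lead to indices of smaller rank, is
triangular. -/
theorem Matrix.det_eq_one_of_rank {J R : Type*} [Fintype J] [DecidableEq J] [CommRing R]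
    (N : Matrix J J R) (ρ : J → ℕ) (h₁ : ∀ i, N i i = 1)
    (h₂ : ∀ i j, i ≠ j → N i j ≠ 0 → ρ j < ρ i) : N.det = 1 := by
  have hN : N.BlockTriangular (OrderDual.toDual ∘ ρ) := by
    intro i j hij
    by_contra h0
    have hij' : ρ i < ρ j := hij
    have := h₂ i j (by rintro rfl; exact lt_irrefl _ hij') h0
    omega
  rw [hN.det]
  refine Finset.prod_eq_one fun a _ => ?_
  have h : N.toSquareBlock (OrderDual.toDual ∘ ρ) a = 1 := ?_
  · rw [h, Matrix.det_one]
  ext i j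
  rcases eq_or_ne i j with rfl | hij
  · simp [toSquareBlock, toSquareBlockProp, h₁]
  · rw [one_apply_ne hij]
    by_contra h0
    have := h₂ i j (fun h => hij (Subtype.ext h)) h0
    have hi : ρ i = ρ j := i.2.trans j.2.symm
    omega

theorem sum_comp_le_sum_of_injective {α β : Type*} [Fintype α] [Fintype β] {φ : α → β}
    (hφ : Function.Injective φ) {g : β → ℝ} (hg : ∀ b, 0 ≤ g b) : ∑ a, g (φ a) ≤ ∑ b, g b := by
  refine (Finset.sum_map Finset.univ ⟨φ, hφ⟩ g).symm.trans_le ?_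
  exact Finset.sum_le_univ_sum_of_nonneg hg

/-- If disjoint copies of the simple graph `H`, indexed by `I` and glued together at the vertex `o`,
form a minor of the connected graph `G`, then the product of their reduced determinants is at most
that of `G`. The map `π` gives the copy and the vertex of `H` which a vertex of `G` is contracted to;
the fibre over the vertex `(b, i)` is connected through the representative `ι (b, i)`, and the union
of the fibres over `o` through the root `r`. -/
theorem Graph.det_pow_card_le_det {W F B F' I : Type*} [Fintype W] [DecidableEq W] [Fintype B]
    [DecidableEq B] [Fintype I] (G : Graph W F) (H : Graph B F') (r : W) (o : B)
    (hG : ∀ x, Relation.ReflTransGen (fun a b => G.adjacencyMatrix a b ≠ 0) r x)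
    (π : W → B × I) (hr : (π r).1 = o) (ι : {b // b ≠ o} × I → W)
    (hι : ∀ u, π (ι u) = (↑u.1, u.2))
    (hreach : ∀ w, ∃ s ∈ insert r (Set.range ι), Relation.ReflTransGen (fun a b =>
      G.adjacencyMatrix a b ≠ 0 ∧ (π a = π b ∨ (π a).1 = o ∧ (π b).1 = o)) s w)
    (hH : ∀ a b, H.adjacencyMatrix a b ≤ 1)
    (hedge : ∀ i a b, H.adjacencyMatrix a b ≠ 0 →
      ∃ w w', π w = (a, i) ∧ π w' = (b, i) ∧ G.adjacencyMatrix w w' ≠ 0) :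
    (H.realReducedLaplacian o).det ^ Fintype.card I ≤ (G.realReducedLaplacian r).det := by
  classical
  obtain ⟨ρ, hρ⟩ := exists_rank_of_forall_reflTransGen _ _ hreach
  -- the coordinates: the values on the image of `ι`, the increments to the parents elsewhere
  let ι' : {b // b ≠ o} × I → {w // w ≠ r} := fun u =>
    ⟨ι u, fun h => u.1.2 (by have := congrArg (fun w => (π w).1) h; simpa [hι, hr] using this)⟩
  have hι' : Function.Injective ι' := by
    intro u v huv
    have h1 : ι u = ι v := congrArg Subtype.val huv
    have h2 := congrArg π h1
    rw [hι, hι, Prod.mk.injEq] at h2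
    exact Prod.ext (Subtype.ext h2.1) h2.2
  let e : ({b // b ≠ o} × I) ⊕ ↥(Set.range ι')ᶜ ≃ {w // w ≠ r} :=
    ((Equiv.ofInjective ι' hι').sumCongr (Equiv.refl _)).trans (Equiv.Set.sumCompl _)
  have heu : ∀ u, ((e (Sum.inl u) : {w // w ≠ r}) : W) = ι u := fun u => rfl
  have hec : ∀ c : ↥(Set.range ι')ᶜ, e (Sum.inr c) = c := fun c => rfl
  have hC : ∀ c : ↥(Set.range ι')ᶜ, ((c : {w // w ≠ r}) : W) ∉ insert r (Set.range ι) := by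
    rintro c (h | ⟨u, hu⟩)
    · exact c.1.2 h
    · exact c.2 ⟨u, Subtype.ext hu⟩
  choose p hpR hpρ using fun c => hρ _ (hC c)
  let Q : Matrix (({b // b ≠ o} × I) ⊕ ↥(Set.range ι')ᶜ) (({b // b ≠ o} × I) ⊕ ↥(Set.range ι')ᶜ) ℝ :=
    Matrix.of fun i j => Sum.elim (fun _ => 0) (fun c => if p c = e j then 1 else 0) i
  have hNdet : (1 - Q).det = 1 := by
    refine det_eq_one_of_rank _ (fun i => ρ (e i)) ?_ ?_
    · rintro (u | c)
      · simp [Q]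
      · have : p c ≠ e (Sum.inr c) := fun h => by
          have := hpρ c
          rw [h, hec] at this
          exact lt_irrefl _ this
        simp [Q, this]
    · rintro (u | c) j hij h0
      · simp [Q, one_apply_ne hij] at h0
      · simp only [Matrix.sub_apply, one_apply_ne hij, of_apply, Sum.elim_inr, Q] at h0
        have : p c = e j := by
          by_contra h
          simp [h] at h0
        rw [← this, hec]
        exact hpρ c
  let X : (({b // b ≠ o} × I) ⊕ ↥(Set.range ι')ᶜ → ℝ) → W → ℝ := fun x =>
    extendByZero r (x ∘ e.symm)
  have hXe : ∀ x i, X x (e i) = x i := fun x i => by simp [X]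
  have hXr : ∀ x, X x r = 0 := fun x => by simp [X]
  have hNu : ∀ x u, ((1 - Q) *ᵥ x) (Sum.inl u) = x (Sum.inl u) := fun x u => by
    rw [sub_mulVec, one_mulVec]
    simp [Q, mulVec, dotProduct]
  have hNc : ∀ x c, ((1 - Q) *ᵥ x) (Sum.inr c) = X x c.1 - X x (p c) := fun x c => by
    rw [sub_mulVec, one_mulVec, Pi.sub_apply, ← hec, hXe]
    congr 1
    simp only [Q, mulVec, dotProduct, of_apply, Sum.elim_inr, ite_mul, one_mul, zero_mul]
    by_cases h : p c = r
    · rw [h, hXr]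
      exact Finset.sum_eq_zero fun j _ => if_neg fun h' => (e j).2 h'.symm
    · have h2 : ∀ j, p c = e j ↔ e.symm ⟨p c, h⟩ = j := fun j => by
        rw [Equiv.symm_apply_eq, ← Subtype.coe_inj]
      simp only [h2, Finset.sum_ite_eq, Finset.mem_univ, if_true]
      rw [← hXe x, Equiv.apply_symm_apply]
  set M := (G.realReducedLaplacian r).submatrix e e with hMdef
  have hM : M.PosDef := (G.posDef_realReducedLaplacian r hG).submatrix e.injective
  have hMq : ∀ x, x ⬝ᵥ M *ᵥ x =
      (∑ q : W × W, (G.adjacencyMatrix q.1 q.2 : ℝ) * (X x q.1 - X x q.2) ^ 2) / 2 := by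
    intro x
    rw [Fintype.sum_prod_type, ← dotProduct_realReducedLaplacian_mulVec, hMdef,
      submatrix_mulVec_equiv]
    rw [comp_equiv_symm_dotProduct]
  have hGnn : ∀ x (q : W × W), 0 ≤ (G.adjacencyMatrix q.1 q.2 : ℝ) * (X x q.1 - X x q.2) ^ 2 :=
    fun x q => mul_nonneg (by exact_mod_cast G.adjacencyMatrix_nonneg _ _) (sq_nonneg _)
  have hG1 : ∀ a b, G.adjacencyMatrix a b ≠ 0 → (1 : ℝ) ≤ G.adjacencyMatrix a b := fun a b h => by
    have := G.adjacencyMatrix_nonneg a b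
    exact_mod_cast (by omega : 1 ≤ G.adjacencyMatrix a b)
  -- the functions on the copies of `H`, vanishing at the common vertex; when the increments are
  -- zero, `X x` is constant on the fibres of `π`, and its values are given by `Y x`
  let Y : (({b // b ≠ o} × I) ⊕ ↥(Set.range ι')ᶜ → ℝ) → I → B → ℝ := fun x i =>
    extendByZero o fun b => x (Sum.inl (b, i))
  have hXY : ∀ x, (∀ c, ((1 - Q) *ᵥ x) (Sum.inr c) = 0) → ∀ w, X x w = Y x (π w).2 (π w).1 := by
    intro x hx w
    induction hn : ρ w using Nat.strong_induction_on generalizing w with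
    | _ n ih =>
    by_cases hw : w = r
    · rw [hw, hXr, hr]; simp [Y]
    obtain ⟨j, hj⟩ := e.surjective ⟨w, hw⟩
    have hjw : ((e j : {w // w ≠ r}) : W) = w := congrArg Subtype.val hj
    rcases j with u | c
    · have h1 := hXe x (Sum.inl u)
      rw [hjw] at h1
      rw [h1, ← hjw, heu, hι]
      simp [Y]
    · rw [hec] at hjw
      have h1 := hx c
      rw [hNc, sub_eq_zero, hjw] at h1
      have h2 := hpρ c
      rw [hjw, hn] at h2
      rw [h1, ih _ h2 _ rfl]
      rcases (hpR c).2 with h3 | ⟨h3, h4⟩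
      · rw [h3, hjw]
      · rw [hjw] at h4
        rw [h3, h4]; simp [Y]
  let D : Matrix ({b // b ≠ o} × I) ({b // b ≠ o} × I) ℝ :=
    blockDiagonal fun _ : I => H.realReducedLaplacian o
  have hDq : ∀ z, z ⬝ᵥ D *ᵥ z = ∑ i, (∑ a, ∑ b, (H.adjacencyMatrix a b : ℝ) *
      (extendByZero o (fun b => z (b, i)) a - extendByZero o (fun b => z (b, i)) b) ^ 2) / 2 := by
    intro z
    simp only [← dotProduct_realReducedLaplacian_mulVec]
    simp only [D, dotProduct, mulVec, Fintype.sum_prod_type_right, blockDiagonal_apply]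
    simp
  have hD : D.PosSemidef := by
    refine .of_dotProduct_mulVec_nonneg ?_ fun z => ?_
    · rw [IsHermitian, blockDiagonal_conjTranspose]
      simp only [(H.isHermitian_realReducedLaplacian o).eq]
      rfl
    · rw [star_trivial, hDq]
      exact Finset.sum_nonneg fun i _ => div_nonneg (Finset.sum_nonneg fun a _ =>
        Finset.sum_nonneg fun b _ => mul_nonneg (by exact_mod_cast H.adjacencyMatrix_nonneg _ _)
          (sq_nonneg _)) two_pos.le
  have hDdet : D.det = (H.realReducedLaplacian o).det ^ Fintype.card I := by
    simp [D, det_blockDiagonal]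
  have hMdet : M.det = (G.realReducedLaplacian r).det := det_submatrix_equiv_self _ _
  rw [← hDdet, ← hMdet]
  refine hM.det_le_det_of_coordinates hNdet hD (fun x => ?_) fun x hx => ?_
  · rw [hMq, le_div_iff₀ two_pos, mul_two]
    -- the edges to the parents are distinct, since the rank decreases along them
    let φ : ↥(Set.range ι')ᶜ ⊕ ↥(Set.range ι')ᶜ → W × W :=
      Sum.elim (fun c => (((c : {w // w ≠ r}) : W), p c)) fun c => (p c, ((c : {w // w ≠ r}) : W))
    have hinj : Function.Injective φ := by
      have hval : ∀ c c' : ↥(Set.range ι')ᶜ, ((c : {w // w ≠ r}) : W) = (c' : {w // w ≠ r}) →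
        c = c' := fun c c' h => Subtype.ext (Subtype.ext h)
      have hne : ∀ c c' : ↥(Set.range ι')ᶜ, ((c : {w // w ≠ r}) : W) = p c' →
          p c = (c' : {w // w ≠ r}) → False := by
        intro c c' h h'
        have h1 := hpρ c
        have h2 := hpρ c'
        rw [h] at h1; rw [← h'] at h2
        omega
      rintro (c | c) (c' | c') h <;>
        simp only [φ, Sum.elim_inl, Sum.elim_inr, Prod.mk.injEq] at h
      · rw [hval _ _ h.1]
      · exact (hne _ _ h.1 h.2).elim
      · exact (hne _ _ h.2 h.1).elim
      · rw [hval _ _ h.2]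
    refine le_trans ?_ (sum_comp_le_sum_of_injective hinj (hGnn x))
    rw [Fintype.sum_sum_type]
    refine add_le_add (Finset.sum_le_sum fun c _ => ?_) (Finset.sum_le_sum fun c _ => ?_)
    · rw [hNc]
      refine le_mul_of_one_le_left (sq_nonneg _) (hG1 _ _ ?_)
      simpa [φ, G.adjacencyMatrix_symm] using (hpR c).1
    · rw [hNc, ← neg_sq, neg_sub]
      exact le_mul_of_one_le_left (sq_nonneg _) (hG1 _ _ (hpR c).1)
  · rw [hMq, hDq, ← Finset.sum_div]
    refine div_le_div_of_nonneg_right ?_ two_pos.le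
    -- the edges of the copies of `H` lift to distinct edges, since `π` recovers them
    choose w w' hw hw' hww' using hedge
    let φ : {t : I × B × B // H.adjacencyMatrix t.2.1 t.2.2 ≠ 0} → W × W := fun t =>
      (w t.1.1 t.1.2.1 t.1.2.2 t.2, w' t.1.1 t.1.2.1 t.1.2.2 t.2)
    have hinj : Function.Injective φ := by
      rintro ⟨⟨i, a, b⟩, ht⟩ ⟨⟨i', a', b'⟩, ht'⟩ h
      simp only [φ, Prod.mk.injEq] at h
      have h1 := congrArg π h.1
      have h2 := congrArg π h.2
      rw [hw, hw, Prod.mk.injEq] at h1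
      rw [hw', hw', Prod.mk.injEq] at h2
      obtain ⟨rfl, rfl⟩ := h1
      obtain ⟨rfl, -⟩ := h2
      rfl
    refine le_trans ?_ (sum_comp_le_sum_of_injective hinj (hGnn x))
    have h1 : ∀ i a b, (H.adjacencyMatrix a b : ℝ) * (Y x i a - Y x i b) ^ 2 ≤
        if H.adjacencyMatrix a b ≠ 0 then (Y x i a - Y x i b) ^ 2 else 0 := by
      intro i a b
      split_ifs with h
      · exact mul_le_of_le_one_left (sq_nonneg _) (by exact_mod_cast hH a b)
      · have : H.adjacencyMatrix a b = 0 := by simpa using h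
        simp [this]
    have h2 : ∀ i, extendByZero o (fun b => (((1 - Q) *ᵥ x) ∘ Sum.inl) (b, i)) = Y x i := by
      intro i
      simp only [Function.comp, hNu, Y]
    simp only [h2]
    calc _ ≤ ∑ i, ∑ a, ∑ b, if H.adjacencyMatrix a b ≠ 0 then (Y x i a - Y x i b) ^ 2 else 0 :=
          Finset.sum_le_sum fun i _ => Finset.sum_le_sum fun a _ => Finset.sum_le_sum fun b _ =>
            h1 i a b
      _ = ∑ t : I × B × B, if H.adjacencyMatrix t.2.1 t.2.2 ≠ 0 then
            (Y x t.1 t.2.1 - Y x t.1 t.2.2) ^ 2 else 0 := by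
          simp only [Fintype.sum_prod_type]
      _ = ∑ t : {t : I × B × B // H.adjacencyMatrix t.2.1 t.2.2 ≠ 0},
            (Y x t.1.1 t.1.2.1 - Y x t.1.1 t.1.2.2) ^ 2 := by
          rw [← Finset.sum_filter]
          exact Finset.sum_subtype _ (by simp) _
      _ ≤ _ := by
          refine Finset.sum_le_sum fun t _ => ?_
          simp only [φ, hXY x hx, hw, hw']
          exact le_mul_of_one_le_left (sq_nonneg _) (hG1 _ _ (hww' _ _ _ t.2))

end Comparison

/-! ### Connected transversals -/

section Transversal

open Relation

/-- Among the connected sets that meet each orbit at most once, one of maximal size meets each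
orbit. -/
theorem exists_connected_transversal {Γ X : Type*} [AddGroup Γ] [AddAction Γ X]
    [Finite (AddAction.orbitRel.Quotient Γ X)] (R : X → X → Prop)
    (hR : ∀ (g : Γ) x y, R x y → R (g +ᵥ x) (g +ᵥ y)) (hconn : ∀ x y, ReflTransGen R x y) (x₀ : X) :
    ∃ t : AddAction.orbitRel.Quotient Γ X → X,
      (∀ q, Quotient.mk (AddAction.orbitRel Γ X) (t q) = q) ∧
      t (Quotient.mk (AddAction.orbitRel Γ X) x₀) = x₀ ∧
      ∀ q, ReflTransGen (fun a b => R a b ∧ a ∈ Set.range t ∧ b ∈ Set.range t) x₀ (t q) := by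
  let mk : X → AddAction.orbitRel.Quotient Γ X := Quotient.mk (AddAction.orbitRel Γ X)
  have hmk : ∀ (g : Γ) x, mk (g +ᵥ x) = mk x := fun g x => Quotient.sound ⟨g, rfl⟩
  have hmk' : ∀ x y, mk x = mk y → ∃ g : Γ, g +ᵥ y = x := fun x y h => Quotient.exact h
  let Good : Set X → Prop := fun S => x₀ ∈ S ∧ Set.InjOn mk S ∧
    ∀ x ∈ S, ReflTransGen (fun a b => R a b ∧ a ∈ S ∧ b ∈ S) x₀ x
  have hfin : ∀ S, Good S → S.Finite := fun S hS => Set.Finite.of_finite_image (Set.toFinite _) hS.2.1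
  have hext : ∀ S, Good S → mk '' S ≠ Set.univ → ∃ S', Good S' ∧ S'.ncard = S.ncard + 1 := by
    intro S hS hne
    have hstep : ∃ y ∈ S, ∃ y', R y y' ∧ mk y' ∉ mk '' S := by
      by_contra! hcl
      refine hne (Set.eq_univ_of_forall fun q => ?_)
      induction q using Quotient.inductionOn with
      | _ x =>
      change mk x ∈ _
      induction hconn x₀ x with
      | refl => exact ⟨x₀, hS.1, rfl⟩
      | @tail a b _ hab ih =>
        obtain ⟨y, hy, hya⟩ := ih
        obtain ⟨g, rfl⟩ := hmk' _ _ hya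
        have := hcl _ hy (g +ᵥ b) (hR g _ _ hab)
        rwa [hmk] at this
    obtain ⟨y, hy, y', hyy', hy'⟩ := hstep
    have hy'S : y' ∉ S := fun h => hy' ⟨y', h, rfl⟩
    have hmono : ∀ x ∈ S, ReflTransGen
        (fun a b => R a b ∧ a ∈ insert y' S ∧ b ∈ insert y' S) x₀ x := fun x hx =>
      ReflTransGen.mono (fun a b h => ⟨h.1, Or.inr h.2.1, Or.inr h.2.2⟩) _ _ (hS.2.2 x hx)
    refine ⟨insert y' S, ⟨Or.inr hS.1, ?_, ?_⟩, Set.ncard_insert_of_notMem hy'S (hfin S hS)⟩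
    · exact (Set.injOn_insert hy'S).2 ⟨hS.2.1, hy'⟩
    · rintro x (rfl | hx)
      · exact (hmono y hy).tail ⟨hyy', Or.inr hy, Or.inl rfl⟩
      · exact hmono x hx
  have hlarge : ∀ n : ℕ, ∃ S, Good S ∧ (mk '' S = Set.univ ∨ n ≤ S.ncard) := by
    intro n
    induction n with
    | zero =>
      refine ⟨{x₀}, ⟨rfl, Set.injOn_singleton _ _, ?_⟩, Or.inr (Nat.zero_le _)⟩
      rintro x rfl
      exact .refl
    | succ n ih =>
      obtain ⟨S, hS, h⟩ := ih
      by_cases hne : mk '' S = Set.univ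
      · exact ⟨S, hS, Or.inl hne⟩
      · obtain ⟨S', hS', hcard⟩ := hext S hS hne
        exact ⟨S', hS', Or.inr (by have := h.resolve_left hne; omega)⟩
  obtain ⟨S, hS, hcard⟩ := hlarge (Nat.card (AddAction.orbitRel.Quotient Γ X) + 1)
  have huniv : mk '' S = Set.univ := hcard.resolve_right fun h => by
    rw [← hS.2.1.ncard_image] at h
    have := Set.ncard_le_card (mk '' S)
    omega
  have hsurj : ∀ q, ∃ x ∈ S, mk x = q := fun q => by
    have : q ∈ mk '' S := huniv ▸ Set.mem_univ q
    exact this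
  choose t htS htq using hsurj
  have hrange : ∀ x ∈ S, t (mk x) = x := fun x hx => hS.2.1 (htS _) hx (htq _)
  refine ⟨t, htq, hrange x₀ hS.1, fun q => ?_⟩
  exact ReflTransGen.mono (fun a b h => ⟨h.1, ⟨_, hrange a h.2.1⟩, ⟨_, hrange b h.2.2⟩⟩)
    _ _ (hS.2.2 _ (htS q))

/-- For a free action, a transversal gives each point a coordinate in the group. -/
theorem exists_coordinate_of_transversal {Γ X : Type*} [AddGroup Γ] [AddAction Γ X]
    (hfree : ∀ (g : Γ) (x : X), g +ᵥ x = x → g = 0) (t : AddAction.orbitRel.Quotient Γ X → X)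
    (ht : ∀ q, Quotient.mk (AddAction.orbitRel Γ X) (t q) = q) :
    ∃ c : X → Γ, (∀ x, c x +ᵥ t (Quotient.mk (AddAction.orbitRel Γ X) x) = x) ∧
      (∀ g x, c (g +ᵥ x) = g + c x) ∧ ∀ q, c (t q) = 0 := by
  have h : ∀ x, ∃ g : Γ, g +ᵥ t (Quotient.mk (AddAction.orbitRel Γ X) x) = x := fun x =>
    Quotient.exact (ht (Quotient.mk _ x)).symm
  choose c hc using h
  have huniq : ∀ (g h : Γ) (x : X), g +ᵥ x = h +ᵥ x → g = h := fun g h x hgh => by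
    have := hfree (-h + g) x (by rw [add_vadd, hgh, neg_vadd_vadd])
    rwa [neg_add_eq_zero, eq_comm] at this
  refine ⟨c, hc, fun g x => ?_, fun q => ?_⟩
  · have h1 := hc (g +ᵥ x)
    have h2 : Quotient.mk (AddAction.orbitRel Γ X) (g +ᵥ x) = Quotient.mk _ x :=
      Quotient.sound ⟨g, rfl⟩
    rw [h2] at h1
    refine huniq _ _ (t (Quotient.mk _ x)) ?_
    rw [h1, add_vadd, hc]
  · have h1 := hc (t q)
    rw [ht] at h1
    exact hfree _ _ h1

end Transversal

/-! ### Sublattices of `ℤ^d` -/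

section Lattice

/-- A generating set of `ℤ^d` contains `d` linearly independent vectors. -/
theorem exists_injective_hom_of_closure_eq_top {d : ℕ} (Δ : Set (Fin d → ℤ))
    (hΔ : AddSubgroup.closure Δ = ⊤) :
    ∃ A : (Fin d → ℤ) →+ (Fin d → ℤ), Function.Injective A ∧ ∀ j, A (Pi.single j 1) ∈ Δ := by
  let c : (Fin d → ℤ) →+ (Fin d → ℚ) := (Int.castAddHom ℚ).compLeft (Fin d)
  have hc : ∀ x i, c x i = x i := fun _ _ => rfl
  have hspan : Submodule.span ℚ (c '' Δ) = ⊤ := by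
    have h1 : ∀ x, c x ∈ Submodule.span ℚ (c '' Δ) := by
      have : AddSubgroup.closure Δ ≤ (Submodule.span ℚ (c '' Δ)).toAddSubgroup.comap c := by
        rw [AddSubgroup.closure_le]
        exact fun x hx => Submodule.subset_span ⟨x, hx, rfl⟩
      rw [hΔ] at this
      exact fun x => this (AddSubgroup.mem_top x)
    rw [eq_top_iff, ← (Pi.basisFun ℚ (Fin d)).span_eq, Submodule.span_le]
    rintro _ ⟨j, rfl⟩
    have : Pi.basisFun ℚ (Fin d) j = c (Pi.single j 1) := by
      ext i
      rw [hc, Pi.basisFun_apply]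
      by_cases h : i = j
      · subst h; simp
      · simp [h]
    rw [this]
    exact h1 _
  obtain ⟨b, hb, hbspan, hli⟩ := exists_linearIndependent ℚ (c '' Δ)
  let basis := Module.Basis.mk hli (by rw [Subtype.range_coe, hbspan, hspan])
  let σ := (Pi.basisFun ℚ (Fin d)).indexEquiv basis
  choose v hv hcv using fun j => hb (σ j).2
  refine ⟨(Fintype.linearCombination ℤ v).toAddMonoidHom, ?_, fun j => ?_⟩
  · rw [injective_iff_map_eq_zero]
    intro a ha
    have ha' : ∑ j, a j • v j = 0 := ha
    have h0 : ∑ j, (a j : ℚ) • ((σ j : b) : Fin d → ℚ) = 0 := by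
      have := congrArg c ha'
      rw [map_sum, map_zero] at this
      rw [← this]
      refine Finset.sum_congr rfl fun j _ => ?_
      rw [map_zsmul, hcv, Int.cast_smul_eq_zsmul]
    have hli' : LinearIndependent ℚ fun j => ((σ j : b) : Fin d → ℚ) := hli.comp σ σ.injective
    funext j
    exact_mod_cast Fintype.linearIndependent_iff.1 hli' _ h0 j
  · have : (Fintype.linearCombination ℤ v) (Pi.single j 1) = v j := by
      rw [Fintype.linearCombination_apply_single, one_smul]
    exact this ▸ hv j

theorem AddMonoidHom.finiteIndex_range_of_injective {d : ℕ} {A : (Fin d → ℤ) →+ (Fin d → ℤ)}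
    (hA : Function.Injective A) : A.range.FiniteIndex := by
  have h1 : Module.finrank ℤ (LinearMap.range A.toIntLinearMap) = Module.finrank ℤ (Fin d → ℤ) :=
    LinearMap.finrank_range_of_inj hA
  have h2 : Finite ((Fin d → ℤ) ⧸ LinearMap.range A.toIntLinearMap) :=
    Submodule.finiteQuotientOfFreeOfRankEq _ h1
  have h3 : (LinearMap.range A.toIntLinearMap).toAddSubgroup = A.range := by
    ext x; rfl
  rw [← h3]
  have h4 : Finite ((Fin d → ℤ) ⧸ (LinearMap.range A.toIntLinearMap).toAddSubgroup) := h2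
  exact AddSubgroup.finiteIndex_of_finite_quotient

theorem FiniteIndexSubgroup.minLength_le {d : ℕ} (Λ : FiniteIndexSubgroup d) {v : Fin d → ℤ}
    (hv : v ∈ Λ.1) (h0 : v ≠ 0) : Λ.minLength ≤ √(∑ i, (v i : ℝ) ^ 2) := by
  refine csInf_le ⟨0, ?_⟩ ⟨v, hv, h0, rfl⟩
  rintro _ ⟨w, -, -, rfl⟩
  exact Real.sqrt_nonneg _

theorem finite_setOf_sqrt_sum_sq_lt (d : ℕ) (N : ℝ) :
    {v : Fin d → ℤ | √(∑ i, (v i : ℝ) ^ 2) < N}.Finite := by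
  refine (Set.finite_Icc (fun _ : Fin d => -⌈N⌉) (fun _ => ⌈N⌉)).subset fun v hv => ?_
  have h : ∀ i, |v i| ≤ ⌈N⌉ := fun i => by
    have h1 : |(v i : ℝ)| ≤ √(∑ i, (v i : ℝ) ^ 2) :=
      Real.abs_le_sqrt (Finset.single_le_sum (f := fun i => (v i : ℝ) ^ 2)
        (fun i _ => sq_nonneg _) (Finset.mem_univ i))
    have h2 : |(v i : ℝ)| ≤ ⌈N⌉ := h1.trans (hv.le.trans (Int.le_ceil N))
    exact_mod_cast h2
  exact ⟨fun i => (abs_le.1 (h i)).1, fun i => (abs_le.1 (h i)).2⟩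

/-- The image of a finite-index subgroup of `ℤ^d` under an injective endomorphism of `ℤ^d`. -/
def FiniteIndexSubgroup.map {d : ℕ} {A : (Fin d → ℤ) →+ (Fin d → ℤ)} (hA : Function.Injective A)
    (Λ : FiniteIndexSubgroup d) : FiniteIndexSubgroup d :=
  ⟨Λ.1.map A, ⟨by
    have := A.finiteIndex_range_of_injective hA
    rw [AddSubgroup.index_map_of_injective _ hA]
    exact mul_ne_zero Λ.2.index_ne_zero this.index_ne_zero⟩⟩

/-- Only finitely many vectors have images of length less than a given bound. -/
theorem FiniteIndexSubgroup.tendsto_map {d : ℕ} {A : (Fin d → ℤ) →+ (Fin d → ℤ)}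
    (hA : Function.Injective A) :
    Tendsto (FiniteIndexSubgroup.map hA) (comap FiniteIndexSubgroup.minLength atTop)
      (comap FiniteIndexSubgroup.minLength atTop) := by
  rw [tendsto_comap_iff, tendsto_atTop]
  intro N
  have hfin : {v : Fin d → ℤ | √(∑ i, (A v i : ℝ) ^ 2) < N}.Finite :=
    (finite_setOf_sqrt_sum_sq_lt d N).preimage hA.injOn
  obtain ⟨N', hN'⟩ := (hfin.image fun v : Fin d → ℤ => √(∑ i, (v i : ℝ) ^ 2)).bddAbove
  filter_upwards [preimage_mem_comap (Ioi_mem_atTop (max N' 0))] with Λ hΛ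
  have hΛ' : max N' 0 < Λ.minLength := hΛ
  refine le_csInf ?_ ?_
  · rcases Set.eq_empty_or_nonempty
      {r : ℝ | ∃ v ∈ Λ.1, v ≠ 0 ∧ r = √(∑ i, (v i : ℝ) ^ 2)} with h | ⟨_, v, hv, h0, -⟩
    · -- a junk value: the infimum of the empty set is `0`
      rw [FiniteIndexSubgroup.minLength, h, Real.sInf_empty] at hΛ'
      exact absurd hΛ' (not_lt.2 (le_max_right _ _))
    · exact ⟨_, A v, ⟨v, hv, rfl⟩, by rwa [Ne, map_eq_zero_iff A hA], rfl⟩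
  · rintro _ ⟨_, ⟨v, hv, rfl⟩, h0, rfl⟩
    by_contra hlt
    have h1 : √(∑ i, (v i : ℝ) ^ 2) ≤ N' := hN' ⟨v, not_le.1 hlt, rfl⟩
    have h2 := Λ.minLength_le hv (by rintro rfl; exact h0 (map_zero A))
    exact absurd (h2.trans (h1.trans (le_max_left _ _))) (not_le.2 hΛ')

end Lattice

/-! ### Copies of the grid inside a connected periodic graph -/

section Copies

open Relation

theorem AddSubgroup.card_orbitRel_quotient {Γ : Type*} [AddGroup Γ] (S : AddSubgroup Γ) :
    Nat.card (AddAction.orbitRel.Quotient S Γ) = S.index := by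
  rw [AddSubgroup.index_eq_card]
  exact Nat.card_congr (QuotientAddGroup.quotientRightRelEquivQuotientLeftRel S)

theorem reflTransGen_symm {α : Type*} {r : α → α → Prop} (hr : ∀ a b, r a b → r b a) {a b : α}
    (h : ReflTransGen r a b) : ReflTransGen r b a := by
  induction h with
  | refl => exact .refl
  | tail _ hbc ih => exact .head (hr _ _ hbc) ih

variable {d : ℕ} {V E : Type*} [AddAction (Fin d → ℤ) V] [AddAction (Fin d → ℤ) E]

theorem PeriodicGraph.adj_vadd (G : PeriodicGraph d V E) (s : Fin d → ℤ) {x y : V}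
    (h : G.Adj x y) : G.Adj (s +ᵥ x) (s +ᵥ y) := by
  obtain ⟨e, he⟩ := h
  exact ⟨s +ᵥ e, G.isLink_vadd s e x y he⟩

theorem PeriodicGraph.reflTransGen_adj {G : PeriodicGraph d V E} (hG : G.toGraph.IsConnected)
    (x y : V) : ReflTransGen G.Adj x y :=
  hG.2 x (G.vertexSet_eq ▸ Set.mem_univ x) y (G.vertexSet_eq ▸ Set.mem_univ y)

/-- The copies of the grid in a connected periodic graph: a vertex `v` belongs, after contraction,
to the vertex `(π v).1` of the copy of the grid with index `(π v).2`, on which `ℤ^d` acts through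
`A`. The fibres of `π` are connected, each through the vertex chosen by `y`; the union of the fibres
over the vertices `0` of all copies is connected; adjacent vertices of the grid have adjacent
fibres in each copy. -/
theorem PeriodicGraph.exists_grid_copies (G : PeriodicGraph d V E) (hG : G.toGraph.IsConnected) :
    ∃ A : (Fin d → ℤ) →+ (Fin d → ℤ), Function.Injective A ∧
    ∃ (π : V → (Fin d → ℤ) × AddAction.orbitRel.Quotient A.range (Fin d → ℤ))
      (y : (Fin d → ℤ) × AddAction.orbitRel.Quotient A.range (Fin d → ℤ) → V)
      (i₀ : AddAction.orbitRel.Quotient A.range (Fin d → ℤ)),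
      (∀ b v, π (A b +ᵥ v) = (b + (π v).1, (π v).2)) ∧
      (∀ p, π (y p) = p) ∧
      (∀ b p, A b +ᵥ y p = y (b + p.1, p.2)) ∧
      (∀ v, ReflTransGen (fun v w => G.Adj v w ∧ π v = π w) (y (π v)) v) ∧
      (∀ i, ReflTransGen (fun v w => G.Adj v w ∧ (π v).1 = 0 ∧ (π w).1 = 0) (y (0, i₀)) (y (0, i))) ∧
      ∀ i j, ∃ v w, G.Adj v w ∧ π v = (0, i) ∧ π w = (Pi.single j 1, i) := by
  have := G.finite_vertexOrbits
  obtain ⟨v₀, -⟩ := hG.1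
  -- a connected transversal `t` of the orbits of vertices; `γ v` is the translate containing `v`
  obtain ⟨t, ht, ht₀, htconn⟩ := exists_connected_transversal (Γ := Fin d → ℤ) G.Adj
    (fun g _ _ h => G.adj_vadd g h) (G.reflTransGen_adj hG) v₀
  obtain ⟨γ, hγ, hγadd, hγt⟩ := exists_coordinate_of_transversal G.free_vertex t ht
  have hγ₀ : γ v₀ = 0 := by rw [← ht₀, hγt]
  have htrans : ∀ v, ReflTransGen (fun a b => G.Adj a b ∧ γ a = γ v ∧ γ b = γ v)
      (γ v +ᵥ v₀) v := by
    intro v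
    have h := ReflTransGen.lift (p := fun a b => G.Adj a b ∧ γ a = γ v ∧ γ b = γ v)
      (fun a => γ v +ᵥ a) ?_ _ _ (htconn (Quotient.mk _ v))
    · simpa only [Function.onFun, hγ] using h
    · rintro a b ⟨hab, ⟨p, rfl⟩, ⟨q, rfl⟩⟩
      exact ⟨G.adj_vadd _ hab, by rw [hγadd, hγt, add_zero], by rw [hγadd, hγt, add_zero]⟩
  -- the graph on `ℤ^d` obtained by contracting all translates of the transversal
  let R : (Fin d → ℤ) → (Fin d → ℤ) → Prop := fun g h => ∃ v w, G.Adj v w ∧ γ v = g ∧ γ w = h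
  have hRinv : ∀ s g h, R g h → R (s + g) (s + h) := by
    rintro s _ _ ⟨v, w, hvw, rfl, rfl⟩
    exact ⟨s +ᵥ v, s +ᵥ w, G.adj_vadd s hvw, hγadd s v, hγadd s w⟩
  have hRconn : ∀ g h, ReflTransGen R g h := by
    intro g h
    have := ReflTransGen.lift (p := R) γ (fun v w hvw => ⟨v, w, hvw, rfl, rfl⟩) _ _
      (G.reflTransGen_adj hG (g +ᵥ v₀) (h +ᵥ v₀))
    simpa only [Function.onFun, hγadd, hγ₀, add_zero] using this
  have hclosure : AddSubgroup.closure {h | R 0 h} = ⊤ := by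
    refine eq_top_iff.2 fun h _ => ?_
    induction hRconn 0 h with
    | refl => exact zero_mem _
    | @tail a b _ hab ih =>
      have h1 : R 0 (-a + b) := by simpa using hRinv (-a) a b hab
      have h2 := add_mem (ih (AddSubgroup.mem_top _)) (AddSubgroup.subset_closure h1)
      simpa using h2
  obtain ⟨A, hA, hAR⟩ := exists_injective_hom_of_closure_eq_top _ hclosure
  have hfi := A.finiteIndex_range_of_injective hA
  have hfin : Finite (AddAction.orbitRel.Quotient A.range (Fin d → ℤ)) :=
    Nat.finite_of_card_ne_zero (by
      rw [AddSubgroup.card_orbitRel_quotient]; exact hfi.index_ne_zero)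
  -- a connected transversal `s` of the cosets of the sublattice
  obtain ⟨s, hs, hs₀, hsconn⟩ := exists_connected_transversal (Γ := A.range) R
    (fun g x y h => hRinv g x y h) hRconn 0
  obtain ⟨c, hc, hcadd, hcs⟩ := exists_coordinate_of_transversal (Γ := A.range)
    (fun g x (h : (g : Fin d → ℤ) + x = x) => Subtype.ext (by simpa using h)) s hs
  let mk : (Fin d → ℤ) → AddAction.orbitRel.Quotient A.range (Fin d → ℤ) := Quotient.mk _
  choose α hα using fun g => (c g).2
  have hαg : ∀ g, A (α g) + s (mk g) = g := fun g => by
    rw [hα]; exact hc g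
  have hmk : ∀ b g, mk (A b + g) = mk g := fun b g => Quotient.sound ⟨⟨A b, b, rfl⟩, rfl⟩
  have hαadd : ∀ b g, α (A b + g) = b + α g := fun b g => by
    refine hA ?_
    have h1 := hcadd ⟨A b, b, rfl⟩ g
    have h2 : ((c (A b + g) : A.range) : Fin d → ℤ) = A b + c g := congrArg Subtype.val h1
    rw [map_add, hα, hα, h2]
  have hαs : ∀ i, α (s i) = 0 := fun i => hA (by rw [hα, hcs, map_zero]; rfl)
  have hα0 : α 0 = 0 := by
    have := hαs (mk 0)
    rwa [hs₀] at this
  refine ⟨A, hA, fun v => (α (γ v), mk (γ v)), fun p => (A p.1 + s p.2) +ᵥ v₀, mk 0,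
    ?_, ?_, ?_, ?_, ?_, ?_⟩
  · intro b v
    simp only [hγadd, hαadd, hmk]
  · rintro ⟨a, i⟩
    simp only [hγadd, hγ₀, add_zero, hαadd, hαs, hmk]
    exact Prod.ext rfl (hs i)
  · rintro b ⟨a, i⟩
    simp only [map_add]
    rw [vadd_vadd, add_assoc]
  · intro v
    simp only [hαg]
    exact ReflTransGen.mono (fun a b h => ⟨h.1, by rw [h.2.1, h.2.2]⟩) _ _ (htrans v)
  · intro i
    have hblock : ∀ g, α g = 0 → ∀ v, γ v = g → ReflTransGen
        (fun v w => G.Adj v w ∧ α (γ v) = 0 ∧ α (γ w) = 0) (g +ᵥ v₀) v := by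
      rintro g hg v rfl
      exact ReflTransGen.mono (fun a b h => ⟨h.1, by rw [h.2.1, hg], by rw [h.2.2, hg]⟩) _ _
        (htrans v)
    have h := ReflTransGen.lift' (p := fun v w => G.Adj v w ∧ α (γ v) = 0 ∧ α (γ w) = 0)
      (fun g => g +ᵥ v₀) ?_ _ _ (hsconn i)
    · have h0 : s (mk 0) = 0 := hs₀
      simpa only [Function.onFun, map_zero, zero_add, h0] using h
    · rintro _ _ ⟨⟨v, w, hvw, hv, hw⟩, ⟨p, rfl⟩, ⟨q, rfl⟩⟩
      refine (hblock _ (hαs p) v hv).trans (.head ⟨hvw, ?_, ?_⟩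
        (reflTransGen_symm (fun a b h => ⟨h.1.symm, h.2.2, h.2.1⟩) (hblock _ (hαs q) w hw)))
      · rw [hv, hαs]
      · rw [hw, hαs]
  · intro i j
    obtain ⟨v, w, hvw, hv, hw⟩ := hAR j
    refine ⟨s i +ᵥ v, s i +ᵥ w, G.adj_vadd _ hvw, ?_, ?_⟩
    · simp only [hγadd, hv, add_zero, hαs]
      exact Prod.ext rfl (hs i)
    · simp only [hγadd, hw, add_comm (s i), hαadd, hαs, add_zero, hmk]
      exact Prod.ext rfl (hs i)

end Copies

/-! ### Finite quotients of periodic graphs -/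

section Quotients

open Relation

variable {d : ℕ} {V E : Type*} [AddAction (Fin d → ℤ) V] [AddAction (Fin d → ℤ) E]

theorem PeriodicGraph.finite_edge_quotient (G : PeriodicGraph d V E) (Λ : AddSubgroup (Fin d → ℤ))
    [Λ.FiniteIndex] : Finite (AddAction.orbitRel.Quotient Λ E) := by
  have := G.finite_edgeOrbits
  exact AddSubgroup.finite_quotient_of_finite_quotient_of_index_ne_zero
    (AddSubgroup.FiniteIndex.index_ne_zero (H := Λ))

theorem PeriodicGraph.quotient_adjacencyMatrix_ne_zero (G : PeriodicGraph d V E)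
    (Λ : AddSubgroup (Fin d → ℤ)) [Λ.FiniteIndex] {v w : V} (h : G.Adj v w)
    (hne : Quotient.mk (AddAction.orbitRel Λ V) v ≠ Quotient.mk (AddAction.orbitRel Λ V) w) :
    (G.quotient Λ).adjacencyMatrix (Quotient.mk _ v) (Quotient.mk _ w) ≠ 0 := by
  have := G.finite_edge_quotient Λ
  obtain ⟨e, he⟩ := h
  have h1 := Graph.one_le_adjacencyMatrix (G := G.quotient Λ) hne
    ⟨Quotient.mk _ e, e, v, w, he, rfl, rfl, rfl⟩
  intro h0
  rw [h0] at h1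
  exact absurd h1 (by norm_num)

theorem PeriodicGraph.reflTransGen_quotient {G : PeriodicGraph d V E}
    (hG : G.toGraph.IsConnected) (Λ : AddSubgroup (Fin d → ℤ)) [Λ.FiniteIndex]
    (x y : AddAction.orbitRel.Quotient Λ V) :
    ReflTransGen (fun a b => (G.quotient Λ).adjacencyMatrix a b ≠ 0) x y := by
  induction x using Quotient.inductionOn with
  | _ x =>
  induction y using Quotient.inductionOn with
  | _ y =>
  refine ReflTransGen.lift' (Quotient.mk (AddAction.orbitRel Λ V)) (fun v w hvw => ?_) _ _
    (G.reflTransGen_adj hG x y)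
  by_cases h : Quotient.mk (AddAction.orbitRel Λ V) v = Quotient.mk (AddAction.orbitRel Λ V) w
  · simp only [Function.onFun, h]
    exact .refl
  · exact .single (G.quotient_adjacencyMatrix_ne_zero Λ hvw h)

theorem PeriodicGraph.quotientComplexity_eq_det {G : PeriodicGraph d V E}
    (hG : G.toGraph.IsConnected) (Λ : AddSubgroup (Fin d → ℤ)) [Λ.FiniteIndex]
    [Fintype (AddAction.orbitRel.Quotient Λ V)] [DecidableEq (AddAction.orbitRel.Quotient Λ V)]
    (r : AddAction.orbitRel.Quotient Λ V) :
    (G.quotientComplexity Λ : ℝ) = ((G.quotient Λ).realReducedLaplacian r).det := by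
  rw [← Graph.complexity_eq_det _ r (G.reflTransGen_quotient hG Λ r)]
  unfold quotientComplexity
  congr!

theorem PeriodicGraph.quotientComplexity_pos {G : PeriodicGraph d V E}
    (hG : G.toGraph.IsConnected) (Λ : AddSubgroup (Fin d → ℤ)) [Λ.FiniteIndex] :
    0 < G.quotientComplexity Λ := by
  classical
  have := G.finite_quotient Λ
  let _ := Fintype.ofFinite (AddAction.orbitRel.Quotient Λ V)
  obtain ⟨v, -⟩ := hG.1
  have h := Graph.posDef_realReducedLaplacian _ _ (G.reflTransGen_quotient hG Λ (Quotient.mk _ v))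
  have h1 := G.quotientComplexity_eq_det hG Λ (Quotient.mk _ v)
  have h2 := h.det_pos
  rw [← h1] at h2
  exact_mod_cast h2

/-! ### The grid -/

theorem gridGraph_adj_add_single (x : Fin d → ℤ) (j : Fin d) :
    (gridGraph d).Adj x (x + Pi.single j 1) :=
  ⟨⟨x, j⟩, Or.inl ⟨rfl, rfl⟩⟩

theorem gridGraph_isConnected (d : ℕ) : (gridGraph d).toGraph.IsConnected := by
  refine ⟨⟨0, Set.mem_univ _⟩, fun x _ y _ => ?_⟩
  have hsymm : ∀ a b, ReflTransGen (gridGraph d).Adj a b → ReflTransGen (gridGraph d).Adj b a :=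
    fun a b h => reflTransGen_symm (fun _ _ h => h.symm) h
  let S : AddSubgroup (Fin d → ℤ) :=
    { carrier := {z | ∀ x, ReflTransGen (gridGraph d).Adj x (x + z)}
      zero_mem' := fun x => by rw [add_zero]
      add_mem' := fun {a b} ha hb x => by
        rw [← add_assoc]; exact (ha x).trans (hb (x + a))
      neg_mem' := fun {a} ha x => hsymm _ _ (by simpa using ha (x + -a)) }
  have hS : ∀ z, z ∈ S := fun z => by
    rw [pi_eq_sum_univ' z]
    refine sum_mem fun j _ => S.zsmul_mem (?_ : _ ∈ S) _
    intro x
    exact .single (gridGraph_adj_add_single x j)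
  simpa using hS (y - x) x

/-- Two steps of the grid together have length at most `2`. -/
theorem sqrt_sum_sq_le_two {z : Fin d → ℤ} (j j' : Fin d) (ε : ℤ) (hε : ε ^ 2 = 1)
    (hz : z = Pi.single j 1 + ε • Pi.single j' 1) : √(∑ i, (z i : ℝ) ^ 2) ≤ 2 := by
  have hsum : ∑ i, (z i) ^ 2 ≤ 4 := by
    have h1 : ∀ i, (z i) ^ 2 ≤ 2 * (Pi.single j 1 : Fin d → ℤ) i + 2 *
        (Pi.single j' 1 : Fin d → ℤ) i := by
      intro i
      subst hz
      simp only [Pi.add_apply, Pi.smul_apply, Pi.single_apply, smul_eq_mul]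
      split_ifs <;> nlinarith [sq_nonneg (1 - ε)]
    refine (Finset.sum_le_sum fun i _ => h1 i).trans ?_
    rw [Finset.sum_add_distrib, ← Finset.mul_sum, ← Finset.mul_sum]
    simp
  rw [Real.sqrt_le_left two_pos.le]
  calc (∑ i, (z i : ℝ) ^ 2) = ((∑ i, (z i) ^ 2 : ℤ) : ℝ) := by push_cast; rfl
    _ ≤ ((4 : ℤ) : ℝ) := by exact_mod_cast hsum
    _ = 2 ^ 2 := by norm_num

theorem FiniteIndexSubgroup.eq_zero_of_two_lt_minLength (Λ : FiniteIndexSubgroup d)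
    (hΛ : 2 < Λ.minLength) {z : Fin d → ℤ} (hz : z ∈ Λ.1) (j j' : Fin d) (ε : ℤ) (hε : ε ^ 2 = 1)
    (h : z = Pi.single j 1 + ε • Pi.single j' 1) : z = 0 := by
  by_contra h0
  exact absurd ((Λ.minLength_le hz h0).trans (sqrt_sum_sq_le_two j j' ε hε h)) (not_le.2 hΛ)

theorem single_add_single_ne_zero (j j' : Fin d) :
    (Pi.single j 1 + (1 : ℤ) • Pi.single j' 1 : Fin d → ℤ) ≠ 0 := by
  intro h
  have := congrFun h j
  simp only [one_smul, Pi.add_apply, Pi.single_eq_same, Pi.zero_apply, Pi.single_apply] at this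
  split_ifs at this <;> omega

/-- Finite quotients of the grid by sublattices without short vectors have no multiple edges. -/
theorem gridGraph_quotient_adjacencyMatrix_le_one (Λ : FiniteIndexSubgroup d)
    (hΛ : 2 < Λ.minLength) (a b : AddAction.orbitRel.Quotient Λ.1 (Fin d → ℤ)) :
    ((gridGraph d).quotient Λ.1).adjacencyMatrix a b ≤ 1 := by
  classical
  simp only [Graph.adjacencyMatrix, Matrix.of_apply]
  split_ifs
  · exact zero_le_one
  have hexact : ∀ x y : Fin d → ℤ, Quotient.mk (AddAction.orbitRel Λ.1 (Fin d → ℤ)) x =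
      Quotient.mk _ y → ∃ l ∈ Λ.1, l + y = x := fun x y h => by
    obtain ⟨l, hl⟩ : x ∈ AddAction.orbit Λ.1 y := Quotient.exact h
    exact ⟨l, l.2, hl⟩
  -- parallel edges with the same base point have the same direction
  have hsame : ∀ e f : GridEdge d,
      Quotient.mk (AddAction.orbitRel Λ.1 (Fin d → ℤ)) e.base = Quotient.mk _ f.base →
      Quotient.mk (AddAction.orbitRel Λ.1 (Fin d → ℤ)) (e.base + Pi.single e.dir 1) =
        Quotient.mk _ (f.base + Pi.single f.dir 1) →
      Quotient.mk (AddAction.orbitRel Λ.1 (GridEdge d)) e = Quotient.mk _ f := by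
    rintro ⟨s, j⟩ ⟨s', j'⟩ h₁ h₂
    obtain ⟨l, hl, rfl⟩ := hexact _ _ h₁
    obtain ⟨m, hm, h⟩ := hexact _ _ h₂
    have h0 := Λ.eq_zero_of_two_lt_minLength hΛ (Λ.1.sub_mem hm hl) j j' (-1) (by norm_num)
      (by simp only at h; rw [neg_smul, one_smul]; linear_combination (exp := 1) h)
    rw [sub_eq_zero] at h0
    subst h0
    have hj : (Pi.single j 1 : Fin d → ℤ) = Pi.single j' 1 := by
      simp only at h; linear_combination (exp := 1) -h
    have hj' : j = j' := by
      have := congrFun hj j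
      rw [Pi.single_eq_same, Pi.single_apply] at this
      by_contra hne
      simp [hne] at this
    subst hj'
    exact Quotient.sound ⟨⟨m, hm⟩, rfl⟩
  -- no two edges are antiparallel
  have hopp : ∀ e f : GridEdge d,
      Quotient.mk (AddAction.orbitRel Λ.1 (Fin d → ℤ)) e.base =
        Quotient.mk _ (f.base + Pi.single f.dir 1) →
      Quotient.mk (AddAction.orbitRel Λ.1 (Fin d → ℤ)) (e.base + Pi.single e.dir 1) =
        Quotient.mk _ f.base → False := by
    rintro ⟨s, j⟩ ⟨s', j'⟩ h₁ h₂
    obtain ⟨l, hl, h⟩ := hexact _ _ h₁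
    obtain ⟨m, hm, h'⟩ := hexact _ _ h₂
    simp only at h h'
    have h1 : m - l = Pi.single j 1 + (1 : ℤ) • Pi.single j' 1 := by
      rw [one_smul]; linear_combination (exp := 1) h' - h
    exact single_add_single_ne_zero j j' (h1 ▸
      Λ.eq_zero_of_two_lt_minLength hΛ (Λ.1.sub_mem hm hl) j j' 1 (by norm_num) h1)
  have hle : {e | ((gridGraph d).quotient Λ.1).IsLink e a b}.ncard ≤ 1 := by
    have := Λ.2
    have := (gridGraph d).finite_edge_quotient Λ.1
    refine Set.ncard_le_one_iff_subsingleton.2 ?_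
    rintro _ ⟨e, x, y, hxy, rfl, hx, hy⟩ _ ⟨f, x', y', hxy', rfl, hx', hy'⟩
    rw [← hx'] at hx
    rw [← hy'] at hy
    rcases hxy with ⟨rfl, rfl⟩ | ⟨rfl, rfl⟩ <;> rcases hxy' with ⟨rfl, rfl⟩ | ⟨rfl, rfl⟩
    · exact hsame e f hx hy
    · exact (hopp e f hx hy).elim
    · exact (hopp e f hy hx).elim
    · exact hsame e f hy hx
  exact_mod_cast hle

/-! ### Comparison of growth rates -/

/-- Each finite quotient of the grid whose lattice `Λ` has no short vectors occurs, in as many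
disjoint copies as the index of the range of `A`, as a minor of the finite quotient of `G` by the
image of `Λ`. -/
theorem PeriodicGraph.exists_quotientComplexity_pow_le {G : PeriodicGraph d V E}
    (hG : G.toGraph.IsConnected) :
    ∃ (A : (Fin d → ℤ) →+ (Fin d → ℤ)) (hA : Function.Injective A),
      ∀ Λ : FiniteIndexSubgroup d, 2 < Λ.minLength →
        have := Λ.2
        have := (Λ.map hA).2
        (gridGraph d).quotientComplexity Λ.1 ^ A.range.index ≤
          G.quotientComplexity (Λ.map hA).1 := by
  classical
  obtain ⟨A, hA, π, y, i₀, hπ, hπy, hy, hblock, hroot, hedge⟩ := G.exists_grid_copies hG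
  refine ⟨A, hA, fun Λ hΛ => ?_⟩
  intro hfi hfi'
  set Λ' : AddSubgroup (Fin d → ℤ) := (Λ.map hA).1 with hΛ'
  have hmem : ∀ b ∈ Λ.1, A b ∈ Λ' := fun b hb => ⟨b, hb, rfl⟩
  have hfinI : Finite (AddAction.orbitRel.Quotient A.range (Fin d → ℤ)) :=
    Nat.finite_of_card_ne_zero (by
      rw [AddSubgroup.card_orbitRel_quotient]
      exact (A.finiteIndex_range_of_injective hA).index_ne_zero)
  have hfinW := G.finite_quotient Λ'
  have hfinB := (gridGraph d).finite_quotient Λ.1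
  let _ := Fintype.ofFinite (AddAction.orbitRel.Quotient A.range (Fin d → ℤ))
  let _ := Fintype.ofFinite (AddAction.orbitRel.Quotient Λ' V)
  let _ := Fintype.ofFinite (AddAction.orbitRel.Quotient Λ.1 (Fin d → ℤ))
  let mkV : V → AddAction.orbitRel.Quotient Λ' V := Quotient.mk _
  let mkB : (Fin d → ℤ) → AddAction.orbitRel.Quotient Λ.1 (Fin d → ℤ) := Quotient.mk _
  have hmkV : ∀ b ∈ Λ.1, ∀ v, mkV (A b +ᵥ v) = mkV v := fun b hb v =>
    Quotient.sound ⟨⟨A b, hmem b hb⟩, rfl⟩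
  have hmkB : ∀ b ∈ Λ.1, ∀ a, mkB (b + a) = mkB a := fun b hb a =>
    Quotient.sound ⟨⟨b, hb⟩, rfl⟩
  have hmkB' : ∀ a a', mkB a = mkB a' → ∃ b ∈ Λ.1, b + a' = a := fun a a' h => by
    obtain ⟨l, hl⟩ : a ∈ AddAction.orbit Λ.1 a' := Quotient.exact h
    exact ⟨l, l.2, hl⟩
  let p : AddAction.orbitRel.Quotient Λ' V → AddAction.orbitRel.Quotient Λ.1 (Fin d → ℤ) ×
      AddAction.orbitRel.Quotient A.range (Fin d → ℤ) :=
    Quotient.lift (fun v => (mkB (π v).1, (π v).2)) (by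
      rintro v w ⟨⟨_, b, hb, rfl⟩, rfl⟩
      change (mkB (π (A b +ᵥ w)).1, (π (A b +ᵥ w)).2) = _
      rw [hπ, hmkB b hb])
  have hp : ∀ v, p (mkV v) = (mkB (π v).1, (π v).2) := fun v => rfl
  have hy' : ∀ a a' i, mkB a = mkB a' → mkV (y (a, i)) = mkV (y (a', i)) := by
    intro a a' i h
    obtain ⟨b, hb, rfl⟩ := hmkB' _ _ h
    rw [← hmkV b hb (y (a', i)), hy]
  have key := Graph.det_pow_card_le_det (G.quotient Λ') ((gridGraph d).quotient Λ.1)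
    (mkV (y (0, i₀))) (mkB 0) (G.reflTransGen_quotient hG Λ' _) p
    (by rw [hp, hπy]) (fun u => mkV (y (u.1.1.out, u.2)))
    (fun u => by rw [hp, hπy]; exact Prod.ext (Quotient.out_eq _) rfl) ?_
    (gridGraph_quotient_adjacencyMatrix_le_one Λ hΛ) ?_
  · rw [← G.quotientComplexity_eq_det hG, ← (gridGraph d).quotientComplexity_eq_det
      (gridGraph_isConnected d), ← Nat.card_eq_fintype_card, AddSubgroup.card_orbitRel_quotient]
      at key
    exact_mod_cast key
  · intro w
    induction w using Quotient.inductionOn with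
    | _ v =>
    have h1 := ReflTransGen.lift' (p := fun a b => (G.quotient Λ').adjacencyMatrix a b ≠ 0 ∧
      (p a = p b ∨ (p a).1 = mkB 0 ∧ (p b).1 = mkB 0)) mkV (fun v w hvw => ?_) _ _ (hblock v)
    · by_cases h0 : mkB (π v).1 = mkB 0
      · refine ⟨_, Or.inl rfl, ?_⟩
        have h2 := ReflTransGen.lift' (p := fun a b => (G.quotient Λ').adjacencyMatrix a b ≠ 0 ∧
          (p a = p b ∨ (p a).1 = mkB 0 ∧ (p b).1 = mkB 0)) mkV (fun v w hvw => ?_) _ _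
          (hroot (π v).2)
        · refine ReflTransGen.trans h2 ?_
          simp only [Function.onFun] at h1
          rwa [hy' _ 0 (π v).2 h0] at h1
        · by_cases hne : mkV v = mkV w
          · simp only [Function.onFun, hne]; exact .refl
          · refine .single ⟨G.quotient_adjacencyMatrix_ne_zero Λ' hvw.1 hne, Or.inr ⟨?_, ?_⟩⟩
            · rw [hp, hvw.2.1]
            · rw [hp, hvw.2.2]
      · refine ⟨_, Or.inr ⟨(⟨mkB (π v).1, h0⟩, (π v).2), rfl⟩, ?_⟩
        simp only [Function.onFun] at h1
        rwa [hy' _ (Quotient.out (mkB (π v).1)) (π v).2 (Quotient.out_eq _).symm] at h1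
    · by_cases hne : mkV v = mkV w
      · simp only [Function.onFun, hne]; exact .refl
      · refine .single ⟨G.quotient_adjacencyMatrix_ne_zero Λ' hvw.1 hne, Or.inl ?_⟩
        rw [hp, hp, hvw.2]
  · intro i a b hab
    have hne : a ≠ b := by
      rintro rfl
      simp [Graph.adjacencyMatrix] at hab
    -- lift an edge of the quotient of the grid, and transport it to the copy with index `i`
    have hlift : ∀ s j, ∃ v w, G.Adj v w ∧ π v = (s, i) ∧ π w = (s + Pi.single j 1, i) := by
      intro s j
      obtain ⟨v, w, hvw, hv, hw⟩ := hedge i j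
      exact ⟨A s +ᵥ v, A s +ᵥ w, G.adj_vadd _ hvw, by rw [hπ, hv, add_zero], by rw [hπ, hw]⟩
    obtain ⟨-, e, x, x', hxx', -, rfl, rfl⟩ : ∃ e, ((gridGraph d).quotient Λ.1).IsLink e a b := by
      by_contra! hno
      refine hab ?_
      simp [Graph.adjacencyMatrix, hno]
    have hgoal : ∃ v w, G.Adj v w ∧ π v = (x, i) ∧ π w = (x', i) := by
      rcases hxx' with ⟨rfl, rfl⟩ | ⟨rfl, rfl⟩
      · exact hlift _ _
      · obtain ⟨v, w, hvw, hv, hw⟩ := hlift e.base e.dir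
        exact ⟨w, v, hvw.symm, hw, hv⟩
    obtain ⟨v, w, hvw, hv, hw⟩ := hgoal
    refine ⟨mkV v, mkV w, by rw [hp, hv], by rw [hp, hw],
      G.quotient_adjacencyMatrix_ne_zero Λ' hvw fun h => hne ?_⟩
    have h1 : p (mkV v) = p (mkV w) := congrArg p h
    rw [hp, hp, hv, hw] at h1
    exact congrArg Prod.fst h1

end Quotients

end

theorem theorem6p2 {d : ℕ} (hd : 1 ≤ d) {V E : Type*} [AddAction (Fin d → ℤ) V]
    [AddAction (Fin d → ℤ) E] (G : PeriodicGraph d V E) (hG : G.toGraph.IsConnected) :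
    G.growthRate ≥ (gridGraph d).growthRate := by
  obtain ⟨A, hA, h⟩ := PeriodicGraph.exists_quotientComplexity_pow_le hG
  have hAi : A.range.index ≠ 0 := (A.finiteIndex_range_of_injective hA).index_ne_zero
  refine le_trans ?_ (limsup_le_limsup_of_le (FiniteIndexSubgroup.tendsto_map hA))
  rw [← limsup_comp]
  refine limsup_le_limsup ?_
  filter_upwards [preimage_mem_comap (Ioi_mem_atTop 2)] with Λ hΛ
  have := Λ.2
  have := (Λ.map hA).2
  have hle := h Λ hΛ
  have hidx : ((Λ.map hA).1.index : ℝ) = Λ.1.index * A.range.index := by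
    exact_mod_cast AddSubgroup.index_map_of_injective Λ.1 hA
  have hpos := PeriodicGraph.quotientComplexity_pos (gridGraph_isConnected d) Λ.1
  have hlog : (A.range.index : ℝ) * Real.log ((gridGraph d).quotientComplexity Λ.1) ≤
      Real.log (G.quotientComplexity (Λ.map hA).1) := by
    rw [← Real.log_pow]
    exact Real.log_le_log (by positivity) (by exact_mod_cast hle)
  have hc : (0 : ℝ) < A.range.index := by positivity
  have hn : (0 : ℝ) < Λ.1.index := by
    have := Λ.2.index_ne_zero
    positivity
  refine EReal.coe_le_coe_iff.2 ?_
  rw [hidx]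
  calc 1 / (Λ.1.index : ℝ) * Real.log ((gridGraph d).quotientComplexity Λ.1)
      = 1 / (Λ.1.index * A.range.index : ℝ) *
        (A.range.index * Real.log ((gridGraph d).quotientComplexity Λ.1)) := by field_simp
    _ ≤ _ := mul_le_mul_of_nonneg_left hlog (by positivity)
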